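/- Let $\mathbb{F}$ be $\mathbb{R}$ or $\mathbb{C}$, let $p,r,s\in[1,\infty)$ with $p\neq 2$, and let $\mathcal{I}$ be a nonempty countable set with counting measure. A function norm over $\mathcal{I}$ is a map $\rho\colon[0,\infty)^{\mathcal{I}}\to[0,\infty]$ such that $\rho(f)=0$ only for $f=0$, $\rho(cf)=c\rho(f)$ for $c\ge 0$ (with $0\cdot\infty=0$), $\rho(f+g)\le\rho(f)+\rho(g)$, $\rho(f)\le\rho(g)$ if $f\le g$, $\rho(f_n)\uparrow\rho(f)$ if $f_n\uparrow f$ pointwise, and, for every finite $E\subseteq\mathcal{I}$, $\rho(\chi_E)<\infty$ and there is a constant $C_E<\infty$ with $\sum_{i\in E}f(i)\le C_E\,\rho(f)$ for all $f$. For a Banach space $X$ put $L_\rho(X)=\{f\in X^{\mathcal{I}}:\rho(\|f\|_X)<\infty\}$, normed by $\|f\|=\rho(\|f\|_X)$. A sequence space over $\mathcal{I}$ is a space $U=L_\rho(\mathbb{F})$ where $\rho$ satisfies $\rho(\chi_{\{n\}})=1$ for all $n\in\mathcal{I}$, and then $U(X)=L_\rho(X)$. Let $L_s(L_r)=L_s([0,1],L_r([0,1]))$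 with Lebesgue measure, in the sense of strongly measurable vector-valued functions, with scalars in $\mathbb{F}$. Let $U$ be a sequence space over $\mathcal{I}$. Suppose that $U(\ell_p)$ complementably embeds into $L_s(L_r)$, that is, there are bounded linear maps $J\colon U(\ell_p)\to L_s(L_r)$ and $P\colon L_s(L_r)\to U(\ell_p)$ with $P\circ J=\mathrm{Id}$. Then $$\min\{r,s\}\le p\le\max\{r,s\}.$$ If, moreover, $p<2$ or $s>1$, then either $p=r$, or $p=s$ and $U$ is lattice isomorphic to $\ell_p(\mathcal{I})$, that is, there is a linear homeomorphism $T$ from $U$ onto $\ell_p(\mathcal{I})$ with $T|f|=|Tf|$ for all $f\in U$. -/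

import Mathlib

open MeasureTheory Filter Topology
open scoped NNReal ENNReal

namespace MixedNorm

/-- A (Banach) function norm, in the sense of Bennett and Sharpley, over the set `I` endowed with
the counting measure (every set is measurable, only the empty set is null, and the sets of finite
measure are the finite ones). It assigns a value in `[0,∞]` to every function `I → [0,∞)`. -/
structure FunctionNorm (I : Type*) where
  toFun : (I → ℝ≥0) → ℝ≥0∞
  eq_zero_iff' : ∀ f, toFun f = 0 ↔ f = 0
  smul' : ∀ (c : ℝ≥0) (f : I → ℝ≥0), toFun (c • f) = c * toFun f
  add_le' : ∀ f g, toFun (f + g) ≤ toFun f + toFun g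
  mono' : ∀ f g, f ≤ g → toFun f ≤ toFun g
  /-- The Fatou property. -/
  fatou' : ∀ (f : ℕ → I → ℝ≥0) (g : I → ℝ≥0), Monotone f →
    (∀ i, Tendsto (fun n => f n i) atTop (𝓝 (g i))) →
    Tendsto (fun n => toFun (f n)) atTop (𝓝 (toFun g))
  indicator_lt_top' : ∀ E : Finset I, toFun ((E : Set I).indicator 1) < ∞
  sum_le' : ∀ E : Finset I, ∃ C : ℝ≥0, ∀ f, ((∑ i ∈ E, f i : ℝ≥0) : ℝ≥0∞) ≤ C * toFun f

/-- The normalization that makes the function space of `ρ` a *sequence space*: the unit vectors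
have norm one. -/
def FunctionNorm.IsSequenceNorm {I : Type*} (ρ : FunctionNorm I) : Prop :=
  ∀ n : I, ρ.toFun (({n} : Set I).indicator 1) = 1

section Space

variable {I : Type*} (ρ : FunctionNorm I) (X : Type*) [NormedAddCommGroup X]

/-- The functions `f : I → X` with `ρ(‖f‖) < ∞`. -/
def finiteNormSubgroup : AddSubgroup (I → X) where
  carrier := {f | ρ.toFun (fun i => ‖f i‖₊) < ∞}
  zero_mem' := by
    have h : ρ.toFun (fun i => ‖(0 : I → X) i‖₊) = 0 := by
      rw [ρ.eq_zero_iff']; ext i; simp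
    change ρ.toFun (fun i => ‖(0 : I → X) i‖₊) < ∞
    rw [h]
    exact ENNReal.zero_lt_top
  add_mem' := by
    intro f g hf hg
    refine lt_of_le_of_lt ((ρ.mono' _ _ fun i => ?_).trans (ρ.add_le' _ _))
      (ENNReal.add_lt_top.2 ⟨hf, hg⟩)
    exact nnnorm_add_le (f i) (g i)
  neg_mem' := by
    intro f hf
    simpa using hf

/-- The vector-valued function space `L_ρ(X) = {f : I → X | ρ(‖f‖) < ∞}`. The scalar-valued space
is `FnSpace ρ 𝕜`. -/
def FnSpace : Type _ := finiteNormSubgroup ρ X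

namespace FnSpace

variable {ρ X}

noncomputable instance : AddCommGroup (FnSpace ρ X) :=
  inferInstanceAs (AddCommGroup (finiteNormSubgroup ρ X))

instance : CoeFun (FnSpace ρ X) (fun _ => I → X) := ⟨fun f => f.1⟩

/-- The value `ρ(‖f‖)`. -/
def enorm (f : FnSpace ρ X) : ℝ≥0∞ := ρ.toFun (fun i => ‖f i‖₊)

lemma enorm_ne_top (f : FnSpace ρ X) : enorm f ≠ ∞ := ne_of_lt f.2

@[simp] lemma coe_zero : ((0 : FnSpace ρ X) : I → X) = 0 := rfl
@[simp] lemma coe_add (f g : FnSpace ρ X) : ((f + g : FnSpace ρ X) : I → X) = f + g := rfl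
@[simp] lemma coe_neg (f : FnSpace ρ X) : ((-f : FnSpace ρ X) : I → X) = -f := rfl

/-- `FnSpace ρ X` is normed by `‖f‖ = ρ(‖f‖)`. -/
noncomputable instance : NormedAddCommGroup (FnSpace ρ X) :=
  AddGroupNorm.toNormedAddCommGroup
    { toFun := fun f => (enorm f).toReal
      map_zero' := by
        have h : enorm (0 : FnSpace ρ X) = 0 := by
          rw [enorm, ρ.eq_zero_iff']; ext i; simp
        simp [h]
      add_le' := by
        intro f g
        rw [← ENNReal.toReal_add (enorm_ne_top f) (enorm_ne_top g)]
        refine ENNReal.toReal_mono (ENNReal.add_ne_top.2 ⟨enorm_ne_top f, enorm_ne_top g⟩) ?_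
        exact (ρ.mono' _ _ fun i => nnnorm_add_le (f i) (g i)).trans (ρ.add_le' _ _)
      neg' := by
        intro f
        simp [enorm]
      eq_zero_of_map_eq_zero' := by
        intro f hf
        have h := ((ENNReal.toReal_eq_zero_iff _).1 hf).resolve_right (enorm_ne_top f)
        rw [enorm, ρ.eq_zero_iff'] at h
        refine Subtype.ext (funext fun i => ?_)
        simpa using congrFun h i }

lemma norm_def (f : FnSpace ρ X) : ‖f‖ = (ρ.toFun (fun i => ‖f i‖₊)).toReal := rfl

variable {𝕜 : Type*} [RCLike 𝕜] [NormedSpace 𝕜 X]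

lemma toFun_smul (c : 𝕜) (f : I → X) :
    ρ.toFun (fun i => ‖c • f i‖₊) = ‖c‖₊ * ρ.toFun (fun i => ‖f i‖₊) := by
  rw [← ρ.smul']
  congr 1
  ext i
  simp [nnnorm_smul]

/-- Scalar multiplication is pointwise. -/
noncomputable instance : Module 𝕜 (FnSpace ρ X) where
  smul c f := ⟨fun i => c • f i, by
    change ρ.toFun (fun i => ‖c • f i‖₊) < ∞
    rw [toFun_smul]
    exact ENNReal.mul_lt_top ENNReal.coe_lt_top f.2⟩
  one_smul f := Subtype.ext (funext fun i => one_smul 𝕜 (f i))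
  mul_smul a b f := Subtype.ext (funext fun i => mul_smul a b (f i))
  smul_zero a := Subtype.ext (funext fun _ => smul_zero a)
  smul_add a f g := Subtype.ext (funext fun i => smul_add a (f i) (g i))
  add_smul a b f := Subtype.ext (funext fun i => add_smul a b (f i))
  zero_smul f := Subtype.ext (funext fun i => zero_smul 𝕜 (f i))

@[simp] lemma coe_smul (c : 𝕜) (f : FnSpace ρ X) : ((c • f : FnSpace ρ X) : I → X) = c • ⇑f := rfl

noncomputable instance : NormedSpace 𝕜 (FnSpace ρ X) where
  norm_smul_le c f := by
    rw [norm_def, norm_def]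
    change (ρ.toFun (fun i => ‖c • f i‖₊)).toReal ≤ _
    rw [toFun_smul]
    simp

/-- The modulus `|f|` of the Banach lattice `L_ρ`: `|f|(i) = |f(i)|`. -/
noncomputable def abs (f : FnSpace ρ 𝕜) : FnSpace ρ 𝕜 :=
  ⟨fun i => ((‖f i‖ : ℝ) : 𝕜), by
    change ρ.toFun (fun i => ‖((‖f i‖ : ℝ) : 𝕜)‖₊) < ∞
    have h : (fun i => ‖((‖f i‖ : ℝ) : 𝕜)‖₊) = fun i => ‖f i‖₊ := by
      ext i; simp
    rw [h]
    exact f.2⟩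

end FnSpace

end Space

/-- `X` complementably embeds into `Y`: there are bounded linear maps `J : X → Y` and `P : Y → X`
with `P ∘ J = Id`. -/
def ComplementablyEmbeds (𝕜 : Type*) [RCLike 𝕜] (X Y : Type*)
    [NormedAddCommGroup X] [NormedSpace 𝕜 X] [NormedAddCommGroup Y] [NormedSpace 𝕜 Y] : Prop :=
  ∃ (J : X →L[𝕜] Y) (P : Y →L[𝕜] X), P.comp J = ContinuousLinearMap.id 𝕜 X

/-- `L_ρ` is lattice isomorphic to `ℓ_p(I)`: there is a linear isomorphism `T` (bounded with bounded
inverse) which preserves the lattice structure, i.e., `T|f| = |Tf|` for all `f` (equivalent over the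
reals to preserving suprema and infima; the inverse then preserves moduli as well). -/
def LatticeIsomorphicLp {I : Type*} (ρ : FunctionNorm I) (𝕜 : Type*) [RCLike 𝕜]
    (p : ℝ≥0∞) [Fact (1 ≤ p)] : Prop :=
  ∃ T : FnSpace ρ 𝕜 ≃L[𝕜] lp (fun _ : I => 𝕜) p,
    ∀ (f : FnSpace ρ 𝕜) (i : I), T f.abs i = ((‖T f i‖ : ℝ) : 𝕜)

/-- Lebesgue measure on `[0,1]`. -/
noncomputable def leb : Measure ℝ := volume.restrict (Set.Icc 0 1)

/-- The mixed-norm Lebesgue space `L_s(L_r)` over `[0,1]`. -/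
abbrev MixedLp (𝕜 : Type*) [RCLike 𝕜] (s r : ℝ≥0∞) [Fact (1 ≤ r)] : Type _ :=
  Lp (Lp 𝕜 r leb) s leb

end MixedNorm

set_option linter.unusedSectionVars false

namespace MixedNorm

/-! Write x_{i,n} for the image under J of the (i,n)-th unit vector of U(ℓ_p), and y_{i,n} for the
(i,n)-th coordinate of P. The unit vectors are 1-unconditional, so averaging over signs bounds the
norm of ∑ y_k(z_k) e_k by C times the average of ‖∑ ±z_k‖, for arbitrary vectors z_k
(`isSystem_of_embedding`). Hence the x_k may be replaced by any u_k on which the y_k stay bounded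
away from zero, however far u_k is from x_k. Upper estimates for signed sums of the u_k then bound
the norm of U(ℓ_p) from above. If u_k is pointwise dominated by x_k, lower estimates bound it from
below.

The u_k are pieces of the x_k cut out by size. Slices between rapidly increasing levels behave like
disjoint functions: at each point, the last nonzero slice dominates the sum of all earlier ones
(`sum_mul_le_of_levels`). In an L_t-space this gives two-sided ℓ_t-estimates. Uniformly bounded
functions on a probability space instead have sums of order √N, by Khintchine's inequalities.

Two dichotomies decide which pieces occur. Truncate in the outer variable, by the L_r-norm of the
values. If y_{i,n} tends to zero along n on all these truncations, for every i, then for every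
sequence of i_k suitable n_k make the x_{i_k,n_k} equivalent to the ℓ_s-basis, with constants
independent of the i_k (`IsSystem.equiv_of_slices`). A constant sequence gives p = s, and distinct
i_k give U ≅ ℓ_p.

Otherwise one row i, an ℓ_p-basis, is frequently detected by functions with inner norms bounded by
some level. Truncate these in the inner variable. If y vanishes asymptotically on all inner
truncations, inner slices give growth N^{1/r}, so p = r (`IsSystem.eq_of_inner_slices`). If not, the
row is detected on uniformly bounded functions, and the growth N^{1/2} forces p = 2
(`IsSystem.eq_two_of_bounded`), which is excluded. Both conclusions follow from this alternative. -/

/-- The signed sum `∑ ε k • x k`. -/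
def signSum {E : Type*} [AddCommGroup E] {N : ℕ} (ε : Fin N → ℤˣ) (x : Fin N → E) : E :=
  ∑ k, (ε k : ℤ) • x k

/-- The average over all choices of signs. -/
noncomputable def signAvg {N : ℕ} (F : (Fin N → ℤˣ) → ℝ) : ℝ := (2 ^ N)⁻¹ * ∑ ε, F ε

/-! ### Averages over signs -/

section Average

variable {N : ℕ}

lemma signAvg_mono {F G : (Fin N → ℤˣ) → ℝ} (h : ∀ ε, F ε ≤ G ε) : signAvg F ≤ signAvg G :=
  mul_le_mul_of_nonneg_left (Finset.sum_le_sum fun ε _ => h ε) (by positivity)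

@[simp] lemma signAvg_const (c : ℝ) : signAvg (fun _ : Fin N → ℤˣ => c) = c := by
  simp [signAvg]

lemma signAvg_nonneg {F : (Fin N → ℤˣ) → ℝ} (h : ∀ ε, 0 ≤ F ε) : 0 ≤ signAvg F :=
  (signAvg_const (N := N) 0).symm.le.trans (signAvg_mono h)

lemma signAvg_le {F : (Fin N → ℤˣ) → ℝ} {c : ℝ} (h : ∀ ε, F ε ≤ c) : signAvg F ≤ c :=
  (signAvg_mono h).trans (signAvg_const c).le

lemma signAvg_mul_left (c : ℝ) (F : (Fin N → ℤˣ) → ℝ) :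
    signAvg (fun ε => c * F ε) = c * signAvg F := by
  simp only [signAvg, ← Finset.mul_sum]; ring

lemma signAvg_add (F G : (Fin N → ℤˣ) → ℝ) :
    signAvg (fun ε => F ε + G ε) = signAvg F + signAvg G := by
  simp only [signAvg, Finset.sum_add_distrib]; ring

lemma signAvg_sub (F G : (Fin N → ℤˣ) → ℝ) :
    signAvg (fun ε => F ε - G ε) = signAvg F - signAvg G := by
  simp only [signAvg, Finset.sum_sub_distrib]; ring

lemma signAvg_pow_le {F : (Fin N → ℤˣ) → ℝ} (h : ∀ ε, 0 ≤ F ε) (q : ℕ) :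
    signAvg F ^ q ≤ signAvg (fun ε => F ε ^ q) := by
  have := Real.pow_arith_mean_le_arith_mean_pow (s := Finset.univ)
    (w := fun _ : Fin N → ℤˣ => ((2 : ℝ) ^ N)⁻¹) (z := F) (by intros; positivity) (by simp)
    (fun ε _ => h ε) q
  simpa only [signAvg, Finset.mul_sum] using this

lemma norm_unit_zsmul {E : Type*} [SeminormedAddCommGroup E] (u : ℤˣ) (x : E) :
    ‖(u : ℤ) • x‖ = ‖x‖ := by
  rcases Int.units_eq_one_or u with rfl | rfl <;> simp

lemma sum_sign_mul_sign (n m : Fin N) :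
    ∑ ε : Fin N → ℤˣ, (ε n : ℤ) * (ε m : ℤ) = if n = m then 2 ^ N else 0 := by
  split_ifs with h
  · subst h
    have : ∀ ε : Fin N → ℤˣ, (ε n : ℤ) * (ε n : ℤ) = 1 := fun ε => by
      rcases Int.units_eq_one_or (ε n) with h | h <;> simp [h]
    simp [this]
  -- Flipping the n-th sign permutes the sign choices and negates the summand, so the sum equals its
  -- own negative.
  · have := Fintype.sum_equiv (Equiv.mulLeft (Pi.mulSingle n (-1) : Fin N → ℤˣ))
      (fun ε => (ε n : ℤ) * (ε m : ℤ)) (fun ε => -((ε n : ℤ) * (ε m : ℤ))) (by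
        intro ε
        simp [Ne.symm h])
    rw [Finset.sum_neg_distrib] at this
    linarith

lemma sum_sign_smul_signSum {E : Type*} [AddCommGroup E] (x : Fin N → E) (n : Fin N) :
    ∑ ε : Fin N → ℤˣ, (ε n : ℤ) • signSum ε x = (2 ^ N : ℤ) • x n := by
  simp only [signSum, Finset.smul_sum, smul_smul]
  rw [Finset.sum_comm]
  simp only [← Finset.sum_smul, sum_sign_mul_sign]
  simp [ite_smul]

/-- The average of ε_n ∑ ε_k x_k is x_n, by orthogonality of the signs. -/
lemma norm_le_signAvg {E : Type*} [NormedAddCommGroup E] [NormedSpace ℝ E] (x : Fin N → E)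
    (n : Fin N) : ‖x n‖ ≤ signAvg fun ε => ‖signSum ε x‖ := by
  have h : ‖(2 ^ N : ℤ) • x n‖ ≤ ∑ ε : Fin N → ℤˣ, ‖signSum ε x‖ := by
    rw [← sum_sign_smul_signSum]
    refine (norm_sum_le _ _).trans (Finset.sum_le_sum fun ε _ => ?_)
    rw [norm_unit_zsmul]
  rw [← Int.cast_smul_eq_zsmul ℝ, norm_smul] at h
  rw [signAvg, inv_mul_eq_div, le_div_iff₀ (by positivity), mul_comm]
  simpa using h

end Average

/-! ### Khintchine's inequalities -/

section Khintchine

variable {N : ℕ}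

/-- By independence the average is ∏ cosh t_k, and cosh t ≤ exp(t²/2). -/
lemma signAvg_exp_le (t : Fin N → ℝ) :
    signAvg (fun ε => Real.exp (signSum ε t)) ≤ Real.exp ((∑ k, t k ^ 2) / 2) := by
  have hsum : ∑ ε : Fin N → ℤˣ, Real.exp (signSum ε t) =
      ∏ k, ∑ u : ℤˣ, Real.exp ((u : ℤ) • t k) := by
    rw [Finset.prod_univ_sum, Fintype.piFinset_univ]
    simp [signSum, Real.exp_sum]
  have h2 : ∀ k, ∑ u : ℤˣ, Real.exp ((u : ℤ) • t k) = 2 * Real.cosh (t k) := fun k => by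
    rw [Real.cosh_eq]; simp; ring
  rw [signAvg, hsum]
  simp only [h2, Finset.prod_mul_distrib]
  simp only [Finset.prod_const, Finset.card_univ, Fintype.card_fin]
  rw [← mul_assoc, inv_mul_cancel₀ (by positivity), one_mul, Finset.sum_div, Real.exp_sum]
  exact Finset.prod_le_prod (fun k _ => (Real.cosh_pos _).le)
    fun k _ => Real.cosh_le_exp_half_sq _

lemma signSum_neg_left {E : Type*} [AddCommGroup E] (ε : Fin N → ℤˣ) (x : Fin N → E) :
    signSum ε (-x) = -signSum ε x := by simp [signSum]

lemma signSum_div (ε : Fin N → ℤˣ) (t : Fin N → ℝ) (c : ℝ) :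
    signSum ε (fun k => t k / c) = signSum ε t / c := by
  simp [signSum, Finset.sum_div, mul_div_assoc]

/-- Subgaussian moment bound: after scaling to σ = 1, use |x|^q / q! ≤ e^|x| ≤ e^x + e^{-x} and
average. Bounding by a separate σ > 0 avoids dividing by a vanishing ℓ_2-norm. -/
lemma signAvg_abs_pow_le (q : ℕ) (t : Fin N → ℝ) {σ : ℝ} (hσ : 0 < σ)
    (ht : ∑ k, t k ^ 2 ≤ σ ^ 2) :
    signAvg (fun ε => |signSum ε t| ^ q) ≤ 2 * Real.exp 1 * q.factorial * σ ^ q := by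
  have key : ∀ τ : Fin N → ℝ, ∑ k, τ k ^ 2 ≤ 1 →
      signAvg (fun ε => Real.exp (signSum ε τ)) ≤ Real.exp 1 := fun τ hτ =>
    (signAvg_exp_le τ).trans (Real.exp_le_exp.2 (by linarith))
  set τ : Fin N → ℝ := fun k => t k / σ with hτdef
  have hτ : ∑ k, τ k ^ 2 ≤ 1 := by
    simp only [hτdef, div_pow, ← Finset.sum_div]
    exact (div_le_one (by positivity)).2 ht
  have h1 := key τ hτ
  have h2 := key (-τ) (by simpa using hτ)
  have hpt : ∀ ε : Fin N → ℤˣ, |signSum ε t| ^ q ≤ (q.factorial * σ ^ q) *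
      (Real.exp (signSum ε τ) + Real.exp (signSum ε (-τ))) := by
    intro ε
    have h3 : |signSum ε t| = σ * |signSum ε τ| := by
      rw [hτdef, signSum_div, abs_div, abs_of_pos hσ]; field_simp
    have h4 := Real.pow_div_factorial_le_exp _ (abs_nonneg (signSum ε τ)) q
    rw [div_le_iff₀ (by positivity)] at h4
    have h5 : Real.exp |signSum ε τ| ≤
        Real.exp (signSum ε τ) + Real.exp (signSum ε (-τ)) := by
      rw [signSum_neg_left]
      rcases abs_cases (signSum ε τ) with ⟨h, _⟩ | ⟨h, _⟩ <;> rw [h] <;>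
        linarith [Real.exp_pos (signSum ε τ), Real.exp_pos (-signSum ε τ)]
    rw [h3, mul_pow]
    calc σ ^ q * |signSum ε τ| ^ q ≤ σ ^ q * (Real.exp |signSum ε τ| * q.factorial) := by gcongr
      _ = (q.factorial * σ ^ q) * Real.exp |signSum ε τ| := by ring
      _ ≤ _ := by gcongr
  calc _ ≤ _ := signAvg_mono hpt
    _ = (q.factorial * σ ^ q) * (signAvg (fun ε => Real.exp (signSum ε τ)) +
        signAvg (fun ε => Real.exp (signSum ε (-τ)))) := by rw [signAvg_mul_left, signAvg_add]
    _ ≤ (q.factorial * σ ^ q) * (Real.exp 1 + Real.exp 1) := by gcongr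
    _ = _ := by ring

lemma signAvg_sq (t : Fin N → ℝ) : signAvg (fun ε => signSum ε t ^ 2) = ∑ k, t k ^ 2 := by
  have h : ∀ ε : Fin N → ℤˣ, signSum ε t ^ 2 = ∑ n, t n * ((ε n : ℤ) • signSum ε t) := by
    intro ε
    rw [pow_two]
    nth_rewrite 1 [signSum]
    rw [Finset.sum_mul]
    exact Finset.sum_congr rfl fun n _ => by simp; ring
  simp only [h, signAvg]
  rw [Finset.sum_comm]
  simp only [← Finset.mul_sum, sum_sign_smul_signSum]
  rw [Finset.mul_sum]
  refine Finset.sum_congr rfl fun n _ => ?_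
  simp; field_simp

variable {𝕜 : Type*} [RCLike 𝕜]

lemma re_signSum (ε : Fin N → ℤˣ) (t : Fin N → 𝕜) :
    RCLike.re (signSum ε t) = signSum ε fun k => RCLike.re (t k) := by
  simp [signSum, map_sum, ← Int.cast_smul_eq_zsmul ℝ, RCLike.smul_re]

lemma im_signSum (ε : Fin N → ℤˣ) (t : Fin N → 𝕜) :
    RCLike.im (signSum ε t) = signSum ε fun k => RCLike.im (t k) := by
  simp [signSum, map_sum, ← Int.cast_smul_eq_zsmul ℝ, RCLike.smul_im]

lemma signAvg_norm_sq (t : Fin N → 𝕜) :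
    signAvg (fun ε => ‖signSum ε t‖ ^ 2) = ∑ k, ‖t k‖ ^ 2 := by
  have h : ∀ z : 𝕜, ‖z‖ ^ 2 = RCLike.re z ^ 2 + RCLike.im z ^ 2 := fun z => by
    rw [← RCLike.normSq_eq_def', RCLike.normSq_apply]; ring
  simp only [h, re_signSum, im_signSum, signAvg_add, signAvg_sq, Finset.sum_add_distrib]

lemma norm_le_abs_re_add_abs_im (z : 𝕜) : ‖z‖ ≤ |RCLike.re z| + |RCLike.im z| := by
  refine le_of_pow_le_pow_left₀ two_ne_zero (by positivity) ?_
  rw [← RCLike.normSq_eq_def', RCLike.normSq_apply]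
  nlinarith [sq_abs (RCLike.re z), sq_abs (RCLike.im z),
    mul_nonneg (abs_nonneg (RCLike.re z)) (abs_nonneg (RCLike.im z))]

/-- The upper Khintchine inequality. -/
lemma exists_signAvg_norm_pow_le (𝕜 : Type*) [RCLike 𝕜] (q : ℕ) : ∃ C : ℝ, 0 < C ∧
    ∀ (N : ℕ) (t : Fin N → 𝕜) (σ : ℝ), 0 < σ → ∑ k, ‖t k‖ ^ 2 ≤ σ ^ 2 →
      signAvg (fun ε => ‖signSum ε t‖ ^ q) ≤ C * σ ^ q := by
  refine ⟨2 ^ q * (4 * Real.exp 1 * q.factorial), by positivity, ?_⟩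
  intro N t σ hσ ht
  have hre : ∑ k, RCLike.re (t k) ^ 2 ≤ σ ^ 2 := (Finset.sum_le_sum fun k _ => by
    rw [← sq_abs]; exact pow_le_pow_left₀ (abs_nonneg _) (RCLike.abs_re_le_norm _) 2).trans ht
  have him : ∑ k, RCLike.im (t k) ^ 2 ≤ σ ^ 2 := (Finset.sum_le_sum fun k _ => by
    rw [← sq_abs]; exact pow_le_pow_left₀ (abs_nonneg _) (RCLike.abs_im_le_norm _) 2).trans ht
  have h1 := signAvg_abs_pow_le q _ hσ hre
  have h2 := signAvg_abs_pow_le q _ hσ him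
  have hpt : ∀ ε : Fin N → ℤˣ, ‖signSum ε t‖ ^ q ≤
      2 ^ q * (|signSum ε fun k => RCLike.re (t k)| ^ q +
        |signSum ε fun k => RCLike.im (t k)| ^ q) := by
    intro ε
    rw [← re_signSum, ← im_signSum]
    set z := signSum ε t
    calc ‖z‖ ^ q ≤ (|RCLike.re z| + |RCLike.im z|) ^ q :=
          pow_le_pow_left₀ (norm_nonneg _) (norm_le_abs_re_add_abs_im z) q
      _ ≤ 2 ^ (q - 1) * (|RCLike.re z| ^ q + |RCLike.im z| ^ q) :=
          add_pow_le (abs_nonneg _) (abs_nonneg _) q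
      _ ≤ _ := by gcongr; norm_num; omega
  calc _ ≤ _ := signAvg_mono hpt
    _ = 2 ^ q * _ := by rw [signAvg_mul_left, signAvg_add]
    _ ≤ 2 ^ q * (2 * Real.exp 1 * q.factorial * σ ^ q + 2 * Real.exp 1 * q.factorial * σ ^ q) := by
      gcongr
    _ = _ := by ring

/-- The lower Khintchine inequality. -/
lemma exists_le_signAvg_norm (𝕜 : Type*) [RCLike 𝕜] : ∃ c : ℝ, 0 < c ∧
    ∀ (N : ℕ) (t : Fin N → 𝕜),
      c * √(∑ k, ‖t k‖ ^ 2) ≤ signAvg (fun ε => ‖signSum ε t‖) := by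
  obtain ⟨C, hC, h⟩ := exists_signAvg_norm_pow_le 𝕜 4
  -- For l > 0, x ≥ x²/l - x⁴/l³. Averaging with l = Aσ uses the exact second moment σ² and the
  -- fourth moment bound Cσ⁴; A = √(2C) makes the negative term half of the positive one.
  refine ⟨(2 * √(2 * C))⁻¹, by positivity, ?_⟩
  intro N t
  rcases (Finset.sum_nonneg fun k _ => sq_nonneg ‖t k‖ : 0 ≤ ∑ k, ‖t k‖ ^ 2).eq_or_lt with h0 | h0
  · rw [← h0]
    simpa using signAvg_nonneg (F := fun ε => ‖signSum ε t‖) fun _ => norm_nonneg _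
  set σ := √(∑ k, ‖t k‖ ^ 2) with hσdef
  have hσ : 0 < σ := Real.sqrt_pos.2 h0
  have hσ2 : σ ^ 2 = ∑ k, ‖t k‖ ^ 2 := Real.sq_sqrt h0.le
  have h4 := h N t σ hσ hσ2.symm.le
  set A := √(2 * C)
  have hA : 0 < A := by positivity
  have hA2 : A ^ 2 = 2 * C := Real.sq_sqrt (by positivity)
  have hpt : ∀ ε : Fin N → ℤˣ, (A * σ)⁻¹ * ‖signSum ε t‖ ^ 2 -
      ((A * σ) ^ 3)⁻¹ * ‖signSum ε t‖ ^ 4 ≤ ‖signSum ε t‖ := by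
    intro ε
    set x := ‖signSum ε t‖
    have hx : 0 ≤ x := norm_nonneg _
    set l := A * σ
    have hl : 0 < l := by positivity
    have : l⁻¹ * x ^ 2 - (l ^ 3)⁻¹ * x ^ 4 = x * ((x / l) - (x / l) ^ 3) := by
      field_simp
    rw [this]
    have hy : 0 ≤ x / l := by positivity
    have : x / l - (x / l) ^ 3 ≤ 1 := by
      rcases le_total (x / l) 1 with h | h
      · have := pow_nonneg hy 3; linarith
      · have : x / l ≤ (x / l) ^ 3 := le_self_pow₀ h (by norm_num)
        linarith
    nlinarith
  have h5 := signAvg_mono hpt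
  rw [signAvg_sub, signAvg_mul_left, signAvg_mul_left, signAvg_norm_sq, ← hσ2] at h5
  refine le_trans ?_ h5
  have h6 : ((A * σ) ^ 3)⁻¹ * signAvg (fun ε => ‖signSum ε t‖ ^ 4) ≤
      ((A * σ) ^ 3)⁻¹ * (C * σ ^ 4) := by gcongr
  have h7 : ((A * σ) ^ 3)⁻¹ * (C * σ ^ 4) = (2 * A)⁻¹ * σ := by
    have : C = A ^ 2 / 2 := by linarith
    rw [this]; field_simp
  have h8 : (A * σ)⁻¹ * σ ^ 2 = 2 * ((2 * A)⁻¹ * σ) := by field_simp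
  linarith

end Khintchine

/-! ### Radial truncations and slices between levels -/

section Clamp

variable {E : Type*} [NormedAddCommGroup E] [NormedSpace ℝ E]

/-- The radial truncation at level `K`. -/
noncomputable def clamp (K : ℕ) (v : E) : E := min 1 ((K : ℝ) / ‖v‖) • v

@[simp] lemma clamp_zero (K : ℕ) : clamp K (0 : E) = 0 := by simp [clamp]

lemma clamp_of_norm_le {K : ℕ} {v : E} (h : ‖v‖ ≤ K) : clamp K v = v := by
  rcases eq_or_ne v 0 with rfl | hv
  · simp
  · rw [clamp, min_eq_left, one_smul]
    rwa [le_div_iff₀ (norm_pos_iff.2 hv), one_mul]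

lemma norm_clamp (K : ℕ) (v : E) : ‖clamp K v‖ = min ‖v‖ K := by
  rcases eq_or_ne v 0 with rfl | hv
  · simp
  · have hv' := norm_pos_iff.2 hv
    rw [clamp, norm_smul, Real.norm_of_nonneg (by positivity), min_mul_of_nonneg _ _ hv'.le,
      one_mul, div_mul_cancel₀ _ hv'.ne']

lemma norm_clamp_le (K : ℕ) (v : E) : ‖clamp K v‖ ≤ ‖v‖ := by
  rw [norm_clamp]; exact min_le_left _ _

lemma norm_clamp_le_level (K : ℕ) (v : E) : ‖clamp K v‖ ≤ K := by
  rw [norm_clamp]; exact min_le_right _ _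

/-- With a ≤ b the scaling factors at v and w, the difference is a(v - w) - (b - a)w. When ‖v‖ ≥ K,
a‖v‖ = K ≥ b‖w‖, so the second term is at most a(‖v‖ - ‖w‖). -/
lemma norm_clamp_sub_clamp_le_aux (K : ℕ) {v w : E} (h : ‖w‖ ≤ ‖v‖) :
    ‖clamp K v - clamp K w‖ ≤ 2 * ‖v - w‖ := by
  have hd : ‖v‖ - ‖w‖ ≤ ‖v - w‖ := norm_sub_norm_le v w
  rcases le_total ‖v‖ K with hv | hv
  · rw [clamp_of_norm_le hv, clamp_of_norm_le (h.trans hv)]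
    linarith [norm_nonneg (v - w)]
  rcases eq_or_ne w 0 with rfl | hw
  · simpa using (norm_clamp_le K v).trans (by linarith [norm_nonneg v])
  have hw' := norm_pos_iff.2 hw
  have hv' : 0 < ‖v‖ := hw'.trans_le h
  set a : ℝ := K / ‖v‖ with ha
  have ha0 : 0 ≤ a := by positivity
  have ha1 : a ≤ 1 := (div_le_one hv').2 hv
  have hav : a * ‖v‖ = K := div_mul_cancel₀ _ hv'.ne'
  have hcv : clamp K v = a • v := by rw [clamp, min_eq_right ha1]
  set b : ℝ := min 1 (K / ‖w‖) with hb
  have hab : a ≤ b := le_min ha1 (by rw [ha]; gcongr)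
  have hbw : b * ‖w‖ ≤ K := by
    calc b * ‖w‖ ≤ K / ‖w‖ * ‖w‖ := by gcongr; exact min_le_right _ _
      _ = K := div_mul_cancel₀ _ hw'.ne'
  have hcw : clamp K w = b • w := rfl
  have hsplit : clamp K v - clamp K w = a • (v - w) - (b - a) • w := by
    rw [hcv, hcw, smul_sub, sub_smul]; abel
  calc ‖clamp K v - clamp K w‖ ≤ ‖a • (v - w)‖ + ‖(b - a) • w‖ := by
        rw [hsplit]; exact norm_sub_le _ _
    _ = a * ‖v - w‖ + (b * ‖w‖ - a * ‖w‖) := by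
        rw [norm_smul, norm_smul, Real.norm_of_nonneg ha0, Real.norm_of_nonneg (by linarith)]
        ring
    _ ≤ a * ‖v - w‖ + a * (‖v‖ - ‖w‖) := by linarith
    _ ≤ a * ‖v - w‖ + a * ‖v - w‖ := by gcongr
    _ ≤ 2 * ‖v - w‖ := by nlinarith [norm_nonneg (v - w)]

lemma lipschitzWith_clamp (K : ℕ) : LipschitzWith 2 (clamp K : E → E) := by
  refine LipschitzWith.of_dist_le_mul fun v w => ?_
  rw [dist_eq_norm, dist_eq_norm]
  rcases le_total ‖w‖ ‖v‖ with h | h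
  · exact norm_clamp_sub_clamp_le_aux K h
  · rw [norm_sub_rev, norm_sub_rev v]; exact norm_clamp_sub_clamp_le_aux K h

lemma tendsto_clamp (v : E) : Tendsto (fun K => clamp K v) atTop (𝓝 v) := by
  obtain ⟨K₀, hK₀⟩ := exists_nat_ge ‖v‖
  refine tendsto_const_nhds.congr' ?_
  filter_upwards [eventually_ge_atTop K₀] with K hK
  exact (clamp_of_norm_le (hK₀.trans (by exact_mod_cast hK))).symm

/-- The part of `v` between the levels `K` and `L`. -/
noncomputable def slice (K L : ℕ) (v : E) : E := clamp L v - clamp K v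

lemma slice_of_norm_le {K L : ℕ} (hKL : K ≤ L) {v : E} (h : ‖v‖ ≤ K) : slice K L v = 0 := by
  rw [slice, clamp_of_norm_le h, clamp_of_norm_le (h.trans (by exact_mod_cast hKL)), sub_self]

lemma norm_slice_le_norm_clamp {K L : ℕ} (hKL : K ≤ L) (v : E) :
    ‖slice K L v‖ ≤ ‖clamp L v‖ := by
  have h1 : min 1 ((K : ℝ) / ‖v‖) ≤ min 1 ((L : ℝ) / ‖v‖) :=
    min_le_min le_rfl (by gcongr)
  have h0 : 0 ≤ min 1 ((K : ℝ) / ‖v‖) := by positivity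
  rw [slice, clamp, clamp, ← sub_smul, norm_smul, norm_smul,
    Real.norm_of_nonneg (sub_nonneg.2 h1), Real.norm_of_nonneg (h0.trans h1)]
  gcongr
  linarith

/-- The slices of vectors at rapidly increasing levels behave like disjoint ones. -/
lemma sum_mul_le_of_levels {K L : ℕ → ℕ} (hK : ∀ k, 2 ^ k * ∑ j ∈ Finset.range k, L j ≤ K k)
    {α m : ℝ} (hα : 0 ≤ α) (hm0 : 0 ≤ m) {N : ℕ} (a u v : Fin N → ℝ)
    (ha0 : ∀ k, 0 ≤ a k) (ha : ∀ k, a k ≤ α) (hu0 : ∀ k, 0 ≤ u k) (huv : ∀ k, u k ≤ v k)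
    (huL : ∀ k, u k ≤ L k) (hne : ∀ k, u k ≠ 0 → K k ≤ v k) (hm : ∀ k, a k * v k ≤ m) :
    ∑ k, a k * u k ≤ m + α * ∑ k : Fin N, (1 / 2) ^ (k : ℕ) * v k := by
  induction N with
  | zero => simpa using hm0
  | succ N ih =>
    have hv0 : ∀ k, 0 ≤ v k := fun k => (hu0 k).trans (huv k)
    rw [Fin.sum_univ_castSucc, Fin.sum_univ_castSucc]
    have hrest : 0 ≤ ∑ k : Fin N, (1 / 2 : ℝ) ^ (k.castSucc : ℕ) * v k.castSucc :=
      Finset.sum_nonneg fun k _ => mul_nonneg (by positivity) (hv0 _)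
    by_cases h0 : u (Fin.last N) = 0
    · have := ih (fun k => a k.castSucc) (fun k => u k.castSucc) (fun k => v k.castSucc)
        (fun k => ha0 _) (fun k => ha _) (fun k => hu0 _) (fun k => huv _) (fun k => huL _)
        (fun k => hne _) (fun k => hm _)
      rw [h0, mul_zero, add_zero]
      refine this.trans ?_
      have := mul_nonneg hα (mul_nonneg (by positivity : (0:ℝ) ≤ (1 / 2) ^ (Fin.last N : ℕ))
        (hv0 (Fin.last N)))
      rw [mul_add]
      simp only [Fin.val_castSucc] at *
      linarith
    -- The last slice is nonzero, so v there is at least `K N`, which is 2^N times the sum of all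
    -- earlier `L j`. All earlier slices together are thus absorbed by one term of the error sum,
    -- and the last one costs at most `m`.
    · have h1 : ∑ k : Fin N, a k.castSucc * u k.castSucc ≤ α * ∑ j ∈ Finset.range N, (L j : ℝ) := by
        rw [Finset.sum_range, Finset.mul_sum]
        refine Finset.sum_le_sum fun k _ => ?_
        exact mul_le_mul (ha _) (huL k.castSucc) (hu0 _) hα
      have h2 : (∑ j ∈ Finset.range N, (L j : ℝ)) ≤ (1 / 2) ^ N * v (Fin.last N) := by
        have h3 : (2 : ℝ) ^ N * ∑ j ∈ Finset.range N, (L j : ℝ) ≤ v (Fin.last N) := by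
          refine le_trans ?_ (hne _ h0)
          have := hK N
          simp only [Fin.val_last]
          exact_mod_cast this
        rw [one_div, inv_pow, inv_mul_eq_div, le_div_iff₀ (by positivity), mul_comm]
        exact h3
      have h4 : a (Fin.last N) * u (Fin.last N) ≤ m :=
        (mul_le_mul_of_nonneg_left (huv _) (ha0 _)).trans (hm _)
      have h5 := mul_le_mul_of_nonneg_left h2 hα
      have h6 := mul_nonneg hα hrest
      rw [mul_add]
      simp only [Fin.val_last] at *
      linarith

lemma sum_mul_norm_slice_le {K L : ℕ → ℕ} (hKL : ∀ k, K k ≤ L k)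
    (hK : ∀ k, 2 ^ k * ∑ j ∈ Finset.range k, L j ≤ K k)
    {A m : ℝ} (hA : 0 ≤ A) (hm0 : 0 ≤ m) {N : ℕ} {a : Fin N → ℝ} (v : Fin N → E)
    (ha : ∀ k, 0 ≤ a k) (haA : ∀ k, a k ≤ A) (hm : ∀ k, a k * ‖v k‖ ≤ m) :
    ∑ k, a k * ‖slice (K k) (L k) (v k)‖ ≤ m + A * ∑ k : Fin N, (1 / 2) ^ (k : ℕ) * ‖v k‖ := by
  refine sum_mul_le_of_levels hK hA hm0 a _ _ ha haA (fun k => norm_nonneg _)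
    (fun k => (norm_slice_le_norm_clamp (hKL k) _).trans (norm_clamp_le _ _))
    (fun k => (norm_slice_le_norm_clamp (hKL k) _).trans (norm_clamp_le_level _ _))
    (fun k hk => ?_) hm
  by_contra hlt
  exact hk (by rw [slice_of_norm_le (hKL k) (not_le.1 hlt).le, norm_zero])

lemma le_rpow_sum {N : ℕ} {b : Fin N → ℝ} (hb : ∀ k, 0 ≤ b k) {t : ℝ} (ht : 0 < t) (k : Fin N) :
    b k ≤ (∑ k, b k ^ t) ^ (1 / t) := by
  calc b k = (b k ^ t) ^ (1 / t) := by
        rw [← Real.rpow_mul (hb k), mul_one_div_cancel ht.ne', Real.rpow_one]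
    _ ≤ _ := Real.rpow_le_rpow (Real.rpow_nonneg (hb k) _)
        (Finset.single_le_sum (f := fun k => b k ^ t) (fun k _ => Real.rpow_nonneg (hb k) _)
          (Finset.mem_univ k)) (by positivity)

lemma rpow_sum_rpow_le {N : ℕ} {b : Fin N → ℝ} (hb : ∀ k, 0 ≤ b k) {t : ℝ} (ht : 1 ≤ t) :
    (∑ k, b k ^ t) ^ (1 / t) ≤ ∑ k, b k := by
  have key : ∑ k, b k ^ t ≤ (∑ k, b k) ^ t := by
    induction N with
    | zero => simp [Real.zero_rpow (by linarith : t ≠ 0)]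
    | succ N ih =>
      rw [Fin.sum_univ_castSucc, Fin.sum_univ_castSucc]
      refine le_trans ?_ (Real.add_rpow_le_rpow_add (Finset.sum_nonneg fun k _ => hb _) (hb _) ht)
      gcongr
      exact ih fun k => hb _
  have h0 : 0 ≤ ∑ k, b k := Finset.sum_nonneg fun k _ => hb k
  calc _ ≤ ((∑ k, b k) ^ t) ^ (1 / t) := Real.rpow_le_rpow
        (Finset.sum_nonneg fun k _ => Real.rpow_nonneg (hb k) _) key (by positivity)
    _ = _ := by rw [← Real.rpow_mul h0, mul_one_div_cancel (by linarith), Real.rpow_one]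

end Clamp

/-! ### Truncations and slices in Lebesgue spaces -/

section Lp

variable {α : Type*} {mα : MeasurableSpace α} {μ : Measure α} {p : ℝ≥0∞} [Fact (1 ≤ p)]
  {E F : Type*} [NormedAddCommGroup E] [NormedAddCommGroup F]

lemma toReal_pos_of_one_le (hp : p ≠ ∞) : 0 < p.toReal :=
  ENNReal.toReal_pos (zero_lt_one.trans_le Fact.out).ne' hp

lemma one_le_toReal (hp : p ≠ ∞) : 1 ≤ p.toReal := by
  simpa using ENNReal.toReal_mono hp (Fact.out : 1 ≤ p)

lemma one_le_ne_zero : p ≠ 0 := (zero_lt_one.trans_le (Fact.out : 1 ≤ p)).ne'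

lemma eLpNorm_eq_ofReal_norm (f : Lp E p μ) : eLpNorm f p μ = ENNReal.ofReal ‖f‖ := by
  rw [Lp.norm_def, ENNReal.ofReal_toReal (Lp.eLpNorm_ne_top f)]

/-- Dominated convergence with majorant (c + 1)‖x‖. Linearity of the maps plays no role, so radial
truncation is allowed. -/
lemma tendsto_compLp {T : ℕ → E → E} {c : ℝ≥0} (hT : ∀ n, LipschitzWith c (T n))
    (hT0 : ∀ n, T n 0 = 0) (hlim : ∀ v, Tendsto (fun n => T n v) atTop (𝓝 v)) (hp : p ≠ ∞)
    (x : Lp E p μ) : Tendsto (fun n => (hT n).compLp (hT0 n) x) atTop (𝓝 x) := by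
  have hp0 : 0 < p.toReal := toReal_pos_of_one_le hp
  rw [Lp.tendsto_Lp_iff_tendsto_eLpNorm']
  have hae : ∀ n, ⇑((hT n).compLp (hT0 n) x) - ⇑x =ᵐ[μ] fun ω => T n (x ω) - x ω := fun n => by
    filter_upwards [(hT n).coeFn_compLp (hT0 n) x] with ω h
    simp [h]
  have hint : ∀ n, eLpNorm (⇑((hT n).compLp (hT0 n) x) - ⇑x) p μ =
      (∫⁻ ω, ‖T n (x ω) - x ω‖ₑ ^ p.toReal ∂μ) ^ (1 / p.toReal) := fun n => by
    rw [eLpNorm_congr_ae (hae n), eLpNorm_eq_lintegral_rpow_enorm_toReal one_le_ne_zero hp]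
  simp only [hint]
  have hxm : AEStronglyMeasurable x μ := Lp.aestronglyMeasurable x
  have key : Tendsto (fun n => ∫⁻ ω, ‖T n (x ω) - x ω‖ₑ ^ p.toReal ∂μ) atTop
      (𝓝 (∫⁻ _, 0 ∂μ)) := by
    refine tendsto_lintegral_of_dominated_convergence' (fun ω => ((c + 1) * ‖x ω‖ₑ) ^ p.toReal)
      (fun n => ?_) (fun n => ae_of_all _ fun ω => ?_) ?_ (ae_of_all _ fun ω => ?_)
    · exact ((((hT n).continuous.comp_aestronglyMeasurable hxm).sub hxm).enorm).pow_const _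
    · refine ENNReal.rpow_le_rpow ?_ hp0.le
      refine (enorm_sub_le).trans ?_
      rw [add_mul, one_mul]
      gcongr
      have := (hT n).edist_le_mul (x ω) 0
      simpa [hT0, edist_zero_right] using this
    · simp only [ENNReal.mul_rpow_of_nonneg _ _ hp0.le]
      rw [lintegral_const_mul' _ _ (ENNReal.rpow_ne_top_of_nonneg hp0.le (by finiteness))]
      refine ENNReal.mul_ne_top (ENNReal.rpow_ne_top_of_nonneg hp0.le (by finiteness)) ?_
      exact (lintegral_rpow_enorm_lt_top_of_eLpNorm_lt_top one_le_ne_zero hp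
        (Lp.eLpNorm_lt_top x)).ne
    · have h1 : Tendsto (fun n => ‖T n (x ω) - x ω‖ₑ) atTop (𝓝 0) := by
        have := ((hlim (x ω)).sub_const (x ω)).enorm
        simpa using this
      have := (ENNReal.continuous_rpow_const (y := p.toReal)).tendsto 0 |>.comp h1
      simpa [ENNReal.zero_rpow_of_pos hp0, Function.comp_def] using this
  have := (ENNReal.continuous_rpow_const (y := 1 / p.toReal)).tendsto _ |>.comp key
  simpa [ENNReal.zero_rpow_of_pos (inv_pos.2 hp0), Function.comp_def] using this

/-- The pointwise norm of `f`. -/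
noncomputable def normLp (f : Lp E p μ) : Lp ℝ p μ :=
  (lipschitzWith_one_norm (E := E)).compLp norm_zero f

lemma coeFn_normLp (f : Lp E p μ) : normLp f =ᵐ[μ] fun ω => ‖f ω‖ :=
  LipschitzWith.coeFn_compLp _ _ f

@[simp] lemma norm_normLp (f : Lp E p μ) : ‖normLp f‖ = ‖f‖ := by
  rw [Lp.norm_def, Lp.norm_def, eLpNorm_congr_ae (coeFn_normLp f), eLpNorm_norm]

lemma coeFn_finset_sum {ι : Type*} (S : Finset ι) (f : ι → Lp E p μ) :
    ⇑(∑ i ∈ S, f i) =ᵐ[μ] fun ω => ∑ i ∈ S, f i ω := by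
  classical
  induction S using Finset.induction_on with
  | empty => simpa [Pi.zero_def] using Lp.coeFn_zero E p μ
  | insert i S hi ih =>
    rw [Finset.sum_insert hi]
    filter_upwards [Lp.coeFn_add (f i) (∑ i ∈ S, f i), ih] with ω h1 h2
    rw [h1, Pi.add_apply, h2, Finset.sum_insert hi]

lemma coeFn_signSum {N : ℕ} (ε : Fin N → ℤˣ) (f : Fin N → Lp E p μ) :
    ⇑(signSum ε f) =ᵐ[μ] fun ω => signSum ε fun k => f k ω := by
  have h : ∀ᵐ ω ∂μ, ∀ k, ((ε k : ℤ) • f k : Lp E p μ) ω = (ε k : ℤ) • f k ω := by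
    rw [ae_all_iff]
    intro k
    rcases Int.units_eq_one_or (ε k) with h | h
    · simp [h]
    · filter_upwards [Lp.coeFn_neg (f k)] with ω hω
      rw [h]
      simpa only [Units.val_neg, Units.val_one, neg_smul, one_smul, Pi.neg_apply] using hω
  filter_upwards [h, coeFn_finset_sum Finset.univ fun k => (ε k : ℤ) • f k] with ω h1 h2
  rw [signSum, h2, signSum]
  exact Finset.sum_congr rfl fun k _ => h1 k

/-- Interchanging sum and integral: the L_p-norm of a pointwise ℓ_p-norm is the ℓ_p-norm of the
L_p-norms. -/
lemma eLpNorm_sum_rpow {N : ℕ} (hp : p ≠ ∞) {a : Fin N → ℝ} (ha : ∀ k, 0 ≤ a k)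
    (f : Fin N → Lp E p μ) :
    eLpNorm (fun ω => (∑ k, (a k * ‖f k ω‖) ^ p.toReal) ^ (1 / p.toReal)) p μ =
      ENNReal.ofReal ((∑ k, (a k * ‖f k‖) ^ p.toReal) ^ (1 / p.toReal)) := by
  have hp0 : 0 < p.toReal := toReal_pos_of_one_le hp
  rw [eLpNorm_eq_lintegral_rpow_enorm_toReal one_le_ne_zero hp,
    ← ENNReal.ofReal_rpow_of_nonneg
      (Finset.sum_nonneg fun k _ => Real.rpow_nonneg (mul_nonneg (ha k) (norm_nonneg _)) _)
      (by positivity)]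
  congr 1
  have hpt : ∀ ω, ‖(∑ k, (a k * ‖f k ω‖) ^ p.toReal) ^ (1 / p.toReal)‖ₑ ^ p.toReal =
      ∑ k, ENNReal.ofReal (a k) ^ p.toReal * ‖f k ω‖ₑ ^ p.toReal := fun ω => by
    have h0 : ∀ k, 0 ≤ a k * ‖f k ω‖ := fun k => mul_nonneg (ha k) (norm_nonneg _)
    have h1 : 0 ≤ ∑ k, (a k * ‖f k ω‖) ^ p.toReal :=
      Finset.sum_nonneg fun k _ => Real.rpow_nonneg (h0 k) _
    rw [Real.enorm_of_nonneg (by positivity), ENNReal.ofReal_rpow_of_nonneg (by positivity) hp0.le,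
      ← Real.rpow_mul h1, one_div_mul_cancel hp0.ne', Real.rpow_one,
      ENNReal.ofReal_sum_of_nonneg fun k _ => Real.rpow_nonneg (h0 k) _]
    refine Finset.sum_congr rfl fun k _ => ?_
    rw [← ENNReal.ofReal_rpow_of_nonneg (h0 k) hp0.le, ENNReal.ofReal_mul (ha k), ofReal_norm,
      ENNReal.mul_rpow_of_nonneg _ _ hp0.le]
  simp only [hpt]
  rw [lintegral_finsetSum' _ fun k _ =>
    ((Lp.aestronglyMeasurable (f k)).enorm.pow_const _).const_mul _,
    ENNReal.ofReal_sum_of_nonneg fun k _ => Real.rpow_nonneg (mul_nonneg (ha k) (norm_nonneg _)) _]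
  refine Finset.sum_congr rfl fun k _ => ?_
  rw [lintegral_const_mul' _ _ (ENNReal.rpow_ne_top_of_nonneg hp0.le ENNReal.ofReal_ne_top),
    ← ENNReal.ofReal_rpow_of_nonneg (mul_nonneg (ha k) (norm_nonneg _)) hp0.le,
    ENNReal.ofReal_mul (ha k), ENNReal.mul_rpow_of_nonneg _ _ hp0.le,
    ← eLpNorm_eq_ofReal_norm, eLpNorm_eq_lintegral_rpow_enorm_toReal one_le_ne_zero hp,
    ← ENNReal.rpow_mul, one_div_mul_cancel hp0.ne', ENNReal.rpow_one]

lemma coeFn_const_smul_real (c : ℝ) (f : Lp ℝ p μ) : ⇑(c • f) =ᵐ[μ] fun ω => c * f ω := by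
  filter_upwards [Lp.coeFn_smul c f] with ω h
  rw [h, Pi.smul_apply, smul_eq_mul]

/-- A function whose values are a given linear combination of norms. -/
noncomputable def combNorm {ι : Type*} [Fintype ι] (c : ι → ℝ) (f : ι → Lp E p μ) : Lp ℝ p μ :=
  ∑ i, c i • normLp (f i)

lemma coeFn_combNorm {ι : Type*} [Fintype ι] (c : ι → ℝ) (f : ι → Lp E p μ) :
    combNorm c f =ᵐ[μ] fun ω => ∑ i, c i * ‖f i ω‖ := by
  have h1 : ∀ᵐ ω ∂μ, ∀ i, (c i • normLp (f i) : Lp ℝ p μ) ω = c i * ‖f i ω‖ :=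
    ae_all_iff.2 fun i => by
      filter_upwards [coeFn_normLp (f i), coeFn_const_smul_real (c i) (normLp (f i))] with ω h1 h2
      rw [h2, h1]
  filter_upwards [h1, coeFn_finset_sum Finset.univ fun i => c i • normLp (f i)] with ω h1 h2
  rw [combNorm, h2]
  exact Finset.sum_congr rfl fun i _ => h1 i

lemma norm_combNorm_le {ι : Type*} [Fintype ι] {c : ι → ℝ} (hc : ∀ i, 0 ≤ c i)
    (f : ι → Lp E p μ) : ‖combNorm c f‖ ≤ ∑ i, c i * ‖f i‖ := by
  refine (norm_sum_le _ _).trans (Finset.sum_le_sum fun i _ => ?_)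
  rw [norm_smul, norm_normLp, Real.norm_of_nonneg (hc i)]

variable [NormedSpace ℝ E]

/-- Upper `p`-estimate for slices at rapidly increasing levels. -/
lemma norm_sum_slice_le (hp : p ≠ ∞) {K L : ℕ → ℕ} (hKL : ∀ k, K k ≤ L k)
    (hK : ∀ k, 2 ^ k * ∑ j ∈ Finset.range k, L j ≤ K k) {N : ℕ} {a : Fin N → ℝ} {A : ℝ}
    (ha : ∀ k, 0 ≤ a k) (haA : ∀ k, a k ≤ A) (hA : 0 ≤ A) {x u w : Fin N → Lp E p μ}
    (hu : ∀ k, u k =ᵐ[μ] fun ω => slice (K k) (L k) (x k ω))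
    (hw : ∀ k, ∀ᵐ ω ∂μ, ‖w k ω‖ ≤ a k * ‖u k ω‖) :
    ‖∑ k, w k‖ ≤ (∑ k, (a k * ‖x k‖) ^ p.toReal) ^ (1 / p.toReal) +
      A * ∑ k : Fin N, (1 / 2) ^ (k : ℕ) * ‖x k‖ := by
  have hp0 : 0 < p.toReal := toReal_pos_of_one_le hp
  set h : Lp ℝ p μ := combNorm (fun k : Fin N => A * (1 / 2) ^ (k : ℕ)) x with hh
  have hhn : ‖h‖ ≤ A * ∑ k : Fin N, (1 / 2) ^ (k : ℕ) * ‖x k‖ := by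
    refine (norm_combNorm_le (fun k => by positivity) x).trans_eq ?_
    simp only [Finset.mul_sum, mul_assoc]
  set m : α → ℝ := fun ω => (∑ k, (a k * ‖x k ω‖) ^ p.toReal) ^ (1 / p.toReal) with hm
  have hmm : AEStronglyMeasurable m μ := by
    have : AEMeasurable m μ := by
      refine AEMeasurable.pow_const (Finset.aemeasurable_fun_sum _ fun k _ => ?_) _
      exact ((Lp.aestronglyMeasurable (x k)).norm.aemeasurable.const_mul _).pow_const _
    exact this.aestronglyMeasurable
  have h0 : ∀ ω k, 0 ≤ a k * ‖x k ω‖ := fun ω k => mul_nonneg (ha k) (norm_nonneg _)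
  have hpt : ∀ᵐ ω ∂μ, ‖(∑ k, w k : Lp E p μ) ω‖ ≤ (m + ⇑h) ω := by
    filter_upwards [coeFn_combNorm (fun k : Fin N => A * (1 / 2) ^ (k : ℕ)) x, ae_all_iff.2 hu,
      ae_all_iff.2 hw, coeFn_finset_sum Finset.univ w] with ω h1 h2 h3 h4
    rw [h4, Pi.add_apply, h1]
    simp only [mul_assoc, ← Finset.mul_sum]
    have hs : 0 ≤ ∑ k, (a k * ‖x k ω‖) ^ p.toReal :=
      Finset.sum_nonneg fun k _ => Real.rpow_nonneg (h0 ω k) _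
    refine (norm_sum_le _ _).trans ((Finset.sum_le_sum fun k _ => h3 k).trans ?_)
    simp only [h2]
    -- The bound for the single terms is their pointwise ℓ_p-norm, whose L_p-norm is known exactly.
    exact sum_mul_norm_slice_le hKL hK hA (by positivity) (fun k => x k ω) ha haA
      fun k => le_rpow_sum (h0 ω) hp0 k
  have hs : 0 ≤ ∑ k, (a k * ‖x k‖) ^ p.toReal :=
    Finset.sum_nonneg fun k _ => Real.rpow_nonneg (mul_nonneg (ha k) (norm_nonneg _)) _
  have hfin := (eLpNorm_mono_ae_real hpt).trans
    (eLpNorm_add_le hmm (Lp.aestronglyMeasurable h) (Fact.out : 1 ≤ p))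
  rw [hm, eLpNorm_sum_rpow hp ha, eLpNorm_eq_ofReal_norm, eLpNorm_eq_ofReal_norm,
    ← ENNReal.ofReal_add (by positivity) (norm_nonneg _),
    ENNReal.ofReal_le_ofReal_iff (by positivity)] at hfin
  linarith

/-- Lower `p`-estimate for slices at rapidly increasing levels. -/
lemma rpow_sum_slice_le [NormedSpace ℝ F] (hp : p ≠ ∞) {K L : ℕ → ℕ} (hKL : ∀ k, K k ≤ L k)
    (hK : ∀ k, 2 ^ k * ∑ j ∈ Finset.range k, L j ≤ K k) {N : ℕ} {a : Fin N → ℝ} {A : ℝ}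
    (ha : ∀ k, 0 ≤ a k) (haA : ∀ k, a k ≤ A) (hA : 0 ≤ A) {x u : Fin N → Lp E p μ}
    {w : Fin N → Lp F p μ} (hu : ∀ k, u k =ᵐ[μ] fun ω => slice (K k) (L k) (x k ω))
    (hw : ∀ k, ∀ᵐ ω ∂μ, a k * ‖x k ω‖ ≤ ‖w k ω‖) :
    (∑ k, (a k * ‖u k‖) ^ p.toReal) ^ (1 / p.toReal) ≤ signAvg (fun ε => ‖signSum ε w‖) +
      A * ∑ k : Fin N, (1 / 2) ^ (k : ℕ) * ‖x k‖ := by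
  have hp0 : 0 < p.toReal := toReal_pos_of_one_le hp
  set h : Lp ℝ p μ := combNorm (fun k : Fin N => A * (1 / 2) ^ (k : ℕ)) x with hh
  have hhn : ‖h‖ ≤ A * ∑ k : Fin N, (1 / 2) ^ (k : ℕ) * ‖x k‖ := by
    refine (norm_combNorm_le (fun k => by positivity) x).trans_eq ?_
    simp only [Finset.mul_sum, mul_assoc]
  set g : Lp ℝ p μ := combNorm (fun _ : Fin N → ℤˣ => ((2 : ℝ) ^ N)⁻¹) fun ε => signSum ε w with hg
  have hgn : ‖g‖ ≤ signAvg (fun ε => ‖signSum ε w‖) := by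
    refine (norm_combNorm_le (fun k => by positivity) _).trans_eq ?_
    simp only [signAvg, Finset.mul_sum]
  have h0 : ∀ ω k, 0 ≤ a k * ‖u k ω‖ := fun ω k => mul_nonneg (ha k) (norm_nonneg _)
  have hpt : ∀ᵐ ω ∂μ, ‖(∑ k, (a k * ‖u k ω‖) ^ p.toReal) ^ (1 / p.toReal)‖ ≤ (g + h : Lp ℝ p μ) ω := by
    filter_upwards [coeFn_combNorm (fun k : Fin N => A * (1 / 2) ^ (k : ℕ)) x, ae_all_iff.2 hu,
      ae_all_iff.2 hw, Lp.coeFn_add g h,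
      coeFn_combNorm (fun _ : Fin N → ℤˣ => ((2 : ℝ) ^ N)⁻¹) fun ε => signSum ε w,
      ae_all_iff.2 fun ε => coeFn_signSum ε w] with ω h1 h2 h3 h4 h5 h6
    have hs : 0 ≤ ∑ k, (a k * ‖u k ω‖) ^ p.toReal :=
      Finset.sum_nonneg fun k _ => Real.rpow_nonneg (h0 ω k) _
    rw [h4, Pi.add_apply, h1, h5, Real.norm_of_nonneg (by positivity)]
    -- Passing to the larger ℓ_1-norm loses nothing essential: up to the error, it is still
    -- controlled by the largest single term, and each term is at most the sign average.
    refine (rpow_sum_rpow_le (h0 ω) (one_le_toReal hp)).trans ?_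
    simp only [mul_assoc, ← Finset.mul_sum, h2, h6]
    refine sum_mul_norm_slice_le hKL hK hA (by positivity) (fun k => x k ω) ha haA
      fun k => (h3 k).trans ?_
    simpa only [signAvg] using norm_le_signAvg (fun k => w k ω) k
  have hs : 0 ≤ ∑ k, (a k * ‖u k‖) ^ p.toReal :=
    Finset.sum_nonneg fun k _ => Real.rpow_nonneg (mul_nonneg (ha k) (norm_nonneg _)) _
  have hfin := eLpNorm_mono_ae_real (p := p) hpt
  rw [eLpNorm_sum_rpow hp ha, eLpNorm_eq_ofReal_norm,
    ENNReal.ofReal_le_ofReal_iff (by positivity)] at hfin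
  linarith [norm_add_le g h]

end Lp

/-! ### From pointwise inequalities to norms on a probability space -/

section Probability

variable {α : Type*} {mα : MeasurableSpace α} {μ : Measure α} [IsProbabilityMeasure μ]
  {p : ℝ≥0∞} [Fact (1 ≤ p)] {E F : Type*} [NormedAddCommGroup E] [NormedAddCommGroup F]

lemma enorm_pow_le_lintegral {q : ℕ} (hq : p ≤ q) (f : Lp E p μ) :
    ‖f‖ₑ ^ q ≤ ∫⁻ ω, ‖f ω‖ₑ ^ q ∂μ := by
  have hq1 : (1 : ℝ≥0∞) ≤ q := (Fact.out : 1 ≤ p).trans hq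
  have hq0 : q ≠ 0 := by rintro rfl; simp at hq1
  have h := eLpNorm_le_eLpNorm_of_exponent_le hq (Lp.aestronglyMeasurable f)
  rw [eLpNorm_eq_lintegral_rpow_enorm_toReal (by exact_mod_cast hq0) (ENNReal.natCast_ne_top q),
    ← Lp.enorm_def] at h
  simp only [ENNReal.toReal_natCast, ENNReal.rpow_natCast] at h
  calc ‖f‖ₑ ^ q ≤ ((∫⁻ ω, ‖f ω‖ₑ ^ q ∂μ) ^ (1 / (q : ℝ))) ^ q := by gcongr
    _ = _ := by
      rw [← ENNReal.rpow_natCast, ← ENNReal.rpow_mul, one_div_mul_cancel (by exact_mod_cast hq0),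
        ENNReal.rpow_one]

lemma sum_enorm_pow_le {q : ℕ} (hq : p ≤ q) {ι : Type*} [Fintype ι]
    {g : ι → Lp E p μ} {B : ℝ≥0∞} (h : ∀ᵐ ω ∂μ, ∑ i, ‖g i ω‖ₑ ^ q ≤ B) :
    ∑ i, ‖g i‖ₑ ^ q ≤ B :=
  calc ∑ i, ‖g i‖ₑ ^ q ≤ ∑ i, ∫⁻ ω, ‖g i ω‖ₑ ^ q ∂μ :=
        Finset.sum_le_sum fun i _ => enorm_pow_le_lintegral hq (g i)
    _ = ∫⁻ ω, ∑ i, ‖g i ω‖ₑ ^ q ∂μ :=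
        (lintegral_finsetSum' _ fun i _ => (Lp.aestronglyMeasurable (g i)).enorm.pow_const _).symm
    _ ≤ ∫⁻ _, B ∂μ := lintegral_mono_ae h
    _ = B := by simp

lemma lintegral_enorm_le (f : Lp E p μ) : ∫⁻ ω, ‖f ω‖ₑ ∂μ ≤ ‖f‖ₑ := by
  rw [← eLpNorm_one_eq_lintegral_enorm, Lp.enorm_def]
  exact eLpNorm_le_eLpNorm_of_exponent_le Fact.out (Lp.aestronglyMeasurable f)

lemma sum_enorm_pow_le_sum {q : ℕ} (hq : p ≤ q) {ι κ : Type*}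
    [Fintype ι] [Fintype κ] {u : κ → Lp E p μ} {g : ι → Lp F p μ} {b d : ℝ≥0∞} (hb : b ≠ ∞)
    (h : ∀ᵐ ω ∂μ, ∑ k, ‖u k ω‖ₑ ^ q ≤ b * ∑ i, ‖g i ω‖ₑ + d) :
    ∑ k, ‖u k‖ₑ ^ q ≤ b * ∑ i, ‖g i‖ₑ + d :=
  calc ∑ k, ‖u k‖ₑ ^ q ≤ ∑ k, ∫⁻ ω, ‖u k ω‖ₑ ^ q ∂μ :=
        Finset.sum_le_sum fun i _ => enorm_pow_le_lintegral hq (u i)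
    _ = ∫⁻ ω, ∑ k, ‖u k ω‖ₑ ^ q ∂μ :=
        (lintegral_finsetSum' _ fun i _ => (Lp.aestronglyMeasurable (u i)).enorm.pow_const _).symm
    _ ≤ ∫⁻ ω, (b * ∑ i, ‖g i ω‖ₑ + d) ∂μ := lintegral_mono_ae h
    _ = b * ∑ i, ∫⁻ ω, ‖g i ω‖ₑ ∂μ + d := by
        rw [lintegral_add_right _ measurable_const, lintegral_const_mul' _ _ hb,
          lintegral_finsetSum' _ fun i _ => (Lp.aestronglyMeasurable (g i)).enorm]
        simp
    _ ≤ _ := by gcongr with i; exact lintegral_enorm_le (g i)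

lemma sum_norm_pow_le {q : ℕ} (hq : p ≤ q) {ι : Type*} [Fintype ι]
    {g : ι → Lp E p μ} {B : ℝ} (hB : 0 ≤ B) (h : ∀ᵐ ω ∂μ, ∑ i, ‖g i ω‖ ^ q ≤ B) :
    ∑ i, ‖g i‖ ^ q ≤ B := by
  have key := sum_enorm_pow_le hq (g := g) (B := ENNReal.ofReal B) (by
    filter_upwards [h] with ω h
    simp only [← ofReal_norm, ← ENNReal.ofReal_pow (norm_nonneg _)]
    rw [← ENNReal.ofReal_sum_of_nonneg fun i _ => by positivity]
    exact ENNReal.ofReal_le_ofReal h)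
  simp only [← ofReal_norm, ← ENNReal.ofReal_pow (norm_nonneg _)] at key
  rwa [← ENNReal.ofReal_sum_of_nonneg fun i _ => by positivity,
    ENNReal.ofReal_le_ofReal_iff hB] at key

/-- On the left, monotonicity of norms in the exponent gives ‖f‖^q ≤ ∫ ‖f(ω)‖^q for q ≥ p. On the
right only the L_1-norm appears, which is at most the L_p-norm. This is why later estimates put a
q-th power on the left and a linear sign average on the right. -/
lemma sum_norm_pow_le_sum {q : ℕ} (hq : p ≤ q) {ι κ : Type*}
    [Fintype ι] [Fintype κ] {u : κ → Lp E p μ} {g : ι → Lp F p μ} {b d : ℝ} (hb : 0 ≤ b)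
    (hd : 0 ≤ d) (h : ∀ᵐ ω ∂μ, ∑ k, ‖u k ω‖ ^ q ≤ b * ∑ i, ‖g i ω‖ + d) :
    ∑ k, ‖u k‖ ^ q ≤ b * ∑ i, ‖g i‖ + d := by
  have hs : ∀ G : ι → ℝ, (∀ i, 0 ≤ G i) → ENNReal.ofReal (b * ∑ i, G i + d) =
      ENNReal.ofReal b * ∑ i, ENNReal.ofReal (G i) + ENNReal.ofReal d := fun G hG => by
    rw [ENNReal.ofReal_add (mul_nonneg hb (Finset.sum_nonneg fun i _ => hG i)) hd,
      ENNReal.ofReal_mul hb, ENNReal.ofReal_sum_of_nonneg fun i _ => hG i]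
  have key := sum_enorm_pow_le_sum hq (u := u) (g := g) (b := ENNReal.ofReal b)
    (d := ENNReal.ofReal d) ENNReal.ofReal_ne_top (by
      filter_upwards [h] with ω h
      simp only [← ofReal_norm, ← ENNReal.ofReal_pow (norm_nonneg _)]
      rw [← ENNReal.ofReal_sum_of_nonneg fun i _ => by positivity, ← hs _ fun i => norm_nonneg _]
      exact ENNReal.ofReal_le_ofReal h)
  simp only [← ofReal_norm, ← ENNReal.ofReal_pow (norm_nonneg _)] at key
  rwa [← ENNReal.ofReal_sum_of_nonneg fun i _ => by positivity, ← hs _ fun i => norm_nonneg _,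
    ENNReal.ofReal_le_ofReal_iff
      (add_nonneg (mul_nonneg hb (Finset.sum_nonneg fun i _ => norm_nonneg _)) hd)] at key

end Probability

/-! ### Finite ℓ_t-norms and systems -/

/-- The `ℓ_t`-norm of a finite sequence. -/
noncomputable def lnorm {𝕜 : Type*} [Norm 𝕜] (t : ℝ) {N : ℕ} (a : Fin N → 𝕜) : ℝ :=
  (∑ k, ‖a k‖ ^ t) ^ (1 / t)

section lnorm

variable {E : Type*} [NormedAddCommGroup E] {N : ℕ} {t : ℝ}

lemma lnorm_nonneg (a : Fin N → E) : 0 ≤ lnorm t a := by unfold lnorm; positivity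

lemma norm_le_lnorm (ht : 0 < t) (a : Fin N → E) (k : Fin N) : ‖a k‖ ≤ lnorm t a :=
  le_rpow_sum (fun _ => norm_nonneg _) ht k

lemma rpow_sum_mul_le_lnorm (ht : 0 < t) {c : ℝ} (hc : 0 ≤ c) (a : Fin N → E) {b : Fin N → ℝ}
    (hb : ∀ k, 0 ≤ b k) (h : ∀ k, b k ≤ c * ‖a k‖) : (∑ k, b k ^ t) ^ (1 / t) ≤ c * lnorm t a := by
  calc (∑ k, b k ^ t) ^ (1 / t) ≤ (∑ k, (c * ‖a k‖) ^ t) ^ (1 / t) := by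
        refine Real.rpow_le_rpow (Finset.sum_nonneg fun k _ => Real.rpow_nonneg (hb k) _)
          (Finset.sum_le_sum fun k _ => Real.rpow_le_rpow (hb k) (h k) ht.le) (by positivity)
    _ = (c ^ t * ∑ k, ‖a k‖ ^ t) ^ (1 / t) := by
        simp only [Real.mul_rpow hc (norm_nonneg _), Finset.mul_sum]
    _ = c * lnorm t a := by
        rw [Real.mul_rpow (by positivity) (by positivity), ← Real.rpow_mul hc,
          mul_one_div_cancel ht.ne', Real.rpow_one, lnorm]

lemma lnorm_le_rpow_sum_mul (ht : 0 < t) {c : ℝ} (hc : 0 ≤ c) (a : Fin N → E) {b : Fin N → ℝ}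
    (h : ∀ k, c * ‖a k‖ ≤ b k) : c * lnorm t a ≤ (∑ k, b k ^ t) ^ (1 / t) := by
  calc c * lnorm t a = (c ^ t * ∑ k, ‖a k‖ ^ t) ^ (1 / t) := by
        rw [Real.mul_rpow (by positivity) (by positivity), ← Real.rpow_mul hc,
          mul_one_div_cancel ht.ne', Real.rpow_one, lnorm]
    _ = (∑ k, (c * ‖a k‖) ^ t) ^ (1 / t) := by
        simp only [Real.mul_rpow hc (norm_nonneg _), Finset.mul_sum]
    _ ≤ _ := by
        refine Real.rpow_le_rpow (by positivity)
          (Finset.sum_le_sum fun k _ => Real.rpow_le_rpow (by positivity) (h k) ht.le)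
          (by positivity)

lemma lnorm_const {𝕜 : Type*} [RCLike 𝕜] (N : ℕ) :
    lnorm t (fun _ : Fin N => (1 : 𝕜)) = (N : ℝ) ^ (1 / t) := by
  simp [lnorm]

end lnorm

lemma sum_half_pow_mul_le {N : ℕ} {b : Fin N → ℝ} {C : ℝ} (hC : 0 ≤ C) (h : ∀ k, b k ≤ C) :
    ∑ k : Fin N, (1 / 2 : ℝ) ^ (k : ℕ) * b k ≤ 2 * C := by
  calc _ ≤ ∑ k : Fin N, (1 / 2 : ℝ) ^ (k : ℕ) * C :=
        Finset.sum_le_sum fun k _ => mul_le_mul_of_nonneg_left (h k) (by positivity)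
    _ = (∑ k ∈ Finset.range N, (1 / 2 : ℝ) ^ k) * C := by
        rw [← Finset.sum_mul, Finset.sum_range]
    _ ≤ _ := by gcongr; exact sum_geometric_two_le N

/-- Vectors and functionals that span a complemented copy of a space with an unconditional basis,
whose norm on the span of the first `N` basis vectors is `nu`. -/
structure IsSystem {𝕜 X : Type*} [RCLike 𝕜] [NormedAddCommGroup X] [NormedSpace 𝕜 X] (C : ℝ)
    (x : ℕ → X) (y : ℕ → X →L[𝕜] 𝕜) (nu : ∀ N : ℕ, (Fin N → 𝕜) → ℝ) : Prop where
  norm_signSum_le : ∀ (N : ℕ) (a : Fin N → 𝕜) (ε : Fin N → ℤˣ),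
    ‖signSum ε fun k : Fin N => a k • x k‖ ≤ C * nu N a
  le_signAvg : ∀ (N : ℕ) (z : Fin N → X),
    nu N (fun k => y k (z k)) ≤ C * signAvg fun ε => ‖signSum ε z‖
  nonneg : ∀ (N : ℕ) (a : Fin N → 𝕜), 0 ≤ nu N a
  norm_le : ∀ (N : ℕ) (a : Fin N → 𝕜) (k : Fin N), ‖a k‖ ≤ nu N a
  norm_vec_le : ∀ k, ‖x k‖ ≤ C
  norm_dual_le : ∀ k, ‖y k‖ ≤ C

/-! ### The gliding hump -/

section Selection

variable {𝕜 X : Type*} [RCLike 𝕜] [NormedAddCommGroup X] [NormedSpace 𝕜 X]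

/-- Selection of slices at rapidly increasing levels, on which the functionals are large. -/
lemma exists_slices {T : ℕ → X → X} (hT : ∀ v, Tendsto (fun n => T n v) atTop (𝓝 v))
    {x : ℕ → ℕ → X} {y : ℕ → ℕ → X →L[𝕜] 𝕜} {δ : ℝ} (hδ : 0 < δ)
    (hinf : ∀ k, ∃ᶠ n in atTop, δ ≤ ‖y k n (x k n)‖)
    (hsmall : ∀ k K, ∀ δ' > 0, ∀ᶠ n in atTop, ‖y k n (T K (x k n))‖ < δ') :
    ∃ n K L : ℕ → ℕ, StrictMono n ∧ (∀ k, K k ≤ L k) ∧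
      (∀ k, 2 ^ k * ∑ j ∈ Finset.range k, L j ≤ K k) ∧
      ∀ k, δ / 2 ≤ ‖y k (n k) (T (L k) (x k (n k)) - T (K k) (x k (n k)))‖ := by
  have step : ∀ k n₀ K : ℕ, ∃ n L : ℕ, n₀ < n ∧ K ≤ L ∧
      δ / 2 ≤ ‖y k n (T L (x k n) - T K (x k n))‖ := by
    intro k n₀ K
    -- Truncation at K costs less than δ/4, so the remainder keeps more than 3δ/4. Convergence of
    -- the truncations then leaves δ/2 for a large finite L.
    obtain ⟨n, h1, h2, h3⟩ := ((hinf k).and_eventually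
      ((hsmall k K (δ / 4) (by positivity)).and (eventually_gt_atTop n₀))).exists
    have hlim : Tendsto (fun L => ‖y k n (T L (x k n) - T K (x k n))‖) atTop
        (𝓝 ‖y k n (x k n - T K (x k n))‖) :=
      (((y k n).continuous.tendsto _).comp ((hT (x k n)).sub_const _)).norm
    have hgt : δ / 2 < ‖y k n (x k n - T K (x k n))‖ := by
      rw [map_sub]
      linarith [norm_sub_norm_le (y k n (x k n)) (y k n (T K (x k n)))]
    obtain ⟨L, h4, h5⟩ := ((hlim.eventually_const_lt hgt).and (eventually_ge_atTop K)).exists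
    exact ⟨n, L, h3, h5, h4.le⟩
  choose f g hf hg hfg using step
  -- The state holds the last chosen index and the sum of all upper levels so far; the next lower
  -- level is 2^k times that sum.
  let st : ℕ → ℕ × ℕ := fun k => Nat.rec (0, 0)
    (fun k z => (f k z.1 (2 ^ k * z.2), z.2 + g k z.1 (2 ^ k * z.2))) k
  have hst : ∀ k, st (k + 1) = (f k (st k).1 (2 ^ k * (st k).2),
    (st k).2 + g k (st k).1 (2 ^ k * (st k).2)) := fun k => rfl
  refine ⟨fun k => (st (k + 1)).1, fun k => 2 ^ k * (st k).2,
    fun k => g k (st k).1 (2 ^ k * (st k).2), ?_, fun k => hg _ _ _, fun k => ?_, fun k => ?_⟩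
  · refine strictMono_nat_of_lt_succ fun k => ?_
    rw [hst (k + 1)]
    exact hf _ _ _
  · have : ∀ k, ∑ j ∈ Finset.range k, g j (st j).1 (2 ^ j * (st j).2) = (st k).2 := by
      intro k
      induction k with
      | zero => rfl
      | succ k ih => rw [Finset.sum_range_succ, ih, hst]
    rw [this]
  · exact hfg _ _ _

end Selection

/-! ### Outer slices give ℓ_s -/

section Outer

variable {𝕜 : Type*} [RCLike 𝕜] {α : Type*} {mα : MeasurableSpace α} {μ : Measure α} {s : ℝ≥0∞}
  [Fact (1 ≤ s)] {E : Type*} [NormedAddCommGroup E] [NormedSpace 𝕜 E] [NormedSpace ℝ E]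

/-- A system which is large on slices at rapidly increasing levels is equivalent to the unit vector
basis of `ℓ_s`. -/
lemma IsSystem.equiv_of_slices (hs : s ≠ ∞) {C : ℝ} {x u : ℕ → Lp E s μ}
    {y : ℕ → Lp E s μ →L[𝕜] 𝕜} {nu : ∀ N : ℕ, (Fin N → 𝕜) → ℝ} (h : IsSystem C x y nu)
    {K L : ℕ → ℕ} (hKL : ∀ k, K k ≤ L k)
    (hK : ∀ k, 2 ^ k * ∑ j ∈ Finset.range k, L j ≤ K k)
    (hu : ∀ k, u k =ᵐ[μ] fun ω => slice (K k) (L k) (x k ω))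
    (hyu : ∀ k, 1 / 2 ≤ ‖y k (u k)‖) (N : ℕ) (a : Fin N → 𝕜) :
    nu N a ≤ 6 * C ^ 2 * lnorm s.toReal a ∧ lnorm s.toReal a ≤ 6 * C ^ 2 * nu N a := by
  have ht : 0 < s.toReal := toReal_pos_of_one_le hs
  have hC : 0 ≤ C := (norm_nonneg _).trans (h.norm_vec_le 0)
  have hy0 : ∀ k, y k (u k) ≠ 0 := fun k h0 => by
    have := hyu k; rw [h0, norm_zero] at this; linarith
  constructor
  -- Normalized so that y_k(z_k) = a_k; the factor on u_k is at most 2|a_k|. The upper slice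
  -- estimate gives 2C from its main term and 4C from the error, and `le_signAvg` contributes
  -- another C.
  · set z : Fin N → Lp E s μ := fun k => (a k / y k (u k)) • u k with hz
    have hyz : (fun k : Fin N => y k (z k)) = a := by
      ext k; simp [hz, div_mul_cancel₀ _ (hy0 k)]
    have h1 := h.le_signAvg N z
    rw [hyz] at h1
    refine h1.trans ?_
    have h2 : ∀ ε : Fin N → ℤˣ, ‖signSum ε z‖ ≤ 6 * C * lnorm s.toReal a := by
      intro ε
      have h3 := norm_sum_slice_le (μ := μ) hs hKL hK (a := fun k : Fin N => 2 * ‖a k‖)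
        (A := 2 * lnorm s.toReal a) (x := fun k : Fin N => x k) (u := fun k : Fin N => u k)
        (w := fun k => (ε k : ℤ) • z k) (fun k => by positivity)
        (fun k => by linarith [norm_le_lnorm ht a k]) (by linarith [lnorm_nonneg (t := s.toReal) a])
        (fun k => hu k) (fun k => ?_)
      · refine h3.trans ?_
        have h4 : (∑ k : Fin N, (2 * ‖a k‖ * ‖x k‖) ^ s.toReal) ^ (1 / s.toReal) ≤
            (2 * C) * lnorm s.toReal a :=
          rpow_sum_mul_le_lnorm ht (by positivity) a (fun k => by positivity) fun k => by
            have := h.norm_vec_le k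
            nlinarith [norm_nonneg (a k)]
        have h5 := sum_half_pow_mul_le (N := N) hC fun k => h.norm_vec_le k
        have h6 := mul_le_mul_of_nonneg_left h5
          (by linarith [lnorm_nonneg (t := s.toReal) a] : 0 ≤ 2 * lnorm s.toReal a)
        linarith
      · have hcase : ((ε k : ℤ) • z k : Lp E s μ) = (((ε k : ℤ) : 𝕜) * (a k / y k (u k))) • u k := by
          rw [hz, mul_smul, Int.cast_smul_eq_zsmul]
        filter_upwards [Lp.coeFn_smul (((ε k : ℤ) : 𝕜) * (a k / y k (u k))) (u k)] with ω hω
        rw [hcase, hω, Pi.smul_apply, norm_smul]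
        gcongr
        rw [norm_mul, norm_div]
        have h7 : ‖((ε k : ℤ) : 𝕜)‖ = 1 := by
          rcases Int.units_eq_one_or (ε k) with h | h <;> simp [h]
        rw [h7, one_mul, div_le_iff₀ (norm_pos_iff.2 (hy0 k))]
        nlinarith [hyu k, norm_nonneg (a k)]
    have h3 := mul_le_mul_of_nonneg_left (signAvg_le h2) hC
    linarith
  · have hnu : 0 ≤ nu N a := h.nonneg N a
    have h1 := rpow_sum_slice_le (μ := μ) hs hKL hK (a := fun k : Fin N => ‖a k‖) (A := nu N a)
      (x := fun k : Fin N => x k) (u := fun k : Fin N => u k) (w := fun k : Fin N => a k • x k)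
      (fun k => norm_nonneg _) (fun k => h.norm_le N a k) hnu (fun k => hu k) (fun k => by
        filter_upwards [Lp.coeFn_smul (a k) (x k)] with ω hω
        rw [hω, Pi.smul_apply, norm_smul])
    have h2 : signAvg (fun ε => ‖signSum ε fun k : Fin N => a k • x k‖) ≤ C * nu N a :=
      signAvg_le fun ε => h.norm_signSum_le N a ε
    have h3 := mul_le_mul_of_nonneg_left
      (sum_half_pow_mul_le (N := N) hC fun k => h.norm_vec_le k) hnu
    -- The main term and the error add up to 3C · `nu N a`; the lower bound ‖u_k‖ ≥ 1/(2C) turns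
    -- this into 6C².
    have hu0 : ∀ k, 1 ≤ 2 * C * ‖u k‖ := fun k => by
      have := (hyu k).trans ((y k).le_opNorm (u k))
      nlinarith [h.norm_dual_le k, norm_nonneg (u k)]
    have hC' : 0 < 2 * C := by
      have := hu0 0
      by_contra hcon
      nlinarith [norm_nonneg (u 0)]
    have h4 : (2 * C)⁻¹ * lnorm s.toReal a ≤
        (∑ k : Fin N, (‖a k‖ * ‖u k‖) ^ s.toReal) ^ (1 / s.toReal) :=
      lnorm_le_rpow_sum_mul ht (by positivity) a fun k => by
        rw [inv_mul_le_iff₀ hC']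
        nlinarith [hu0 k, norm_nonneg (a k)]
    rw [inv_mul_le_iff₀ hC'] at h4
    have h5 := mul_le_mul_of_nonneg_left (h1.trans (add_le_add h2 h3)) hC'.le
    linarith

end Outer

lemma le_of_forall_mul_rpow_le {c B a b : ℝ} (hc : 0 < c)
    (h : ∀ N : ℕ, 1 ≤ N → c * (N : ℝ) ^ a ≤ B * (N : ℝ) ^ b) : a ≤ b := by
  by_contra! hab
  have hlim : Tendsto (fun N : ℕ => c * (N : ℝ) ^ (a - b)) atTop atTop :=
    ((tendsto_rpow_atTop (sub_pos.2 hab)).comp tendsto_natCast_atTop_atTop).const_mul_atTop hc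
  obtain ⟨N, h1, h2⟩ := ((hlim.eventually_gt_atTop B).and (eventually_ge_atTop 1)).exists
  have hN : (0 : ℝ) < N := by exact_mod_cast h2
  have h3 := h N h2
  rw [Real.rpow_sub hN, mul_div_assoc', lt_div_iff₀ (Real.rpow_pos_of_pos hN b)] at h1
  linarith

/-! ### Identifying p by growth rates -/

section Exponent

variable {𝕜 X : Type*} [RCLike 𝕜] [NormedAddCommGroup X] [NormedSpace 𝕜 X]

/-- Only equal coefficients are tested. The upper estimate yields N^{1/p} ≲ N^θ. Since ‖u_k‖ is
bounded below, the lower one yields N ≲ N^{1-θ} N^{1/p}. Comparing exponents of N gives both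
inequalities. -/
lemma IsSystem.exponent_eq {C p θ B D δ : ℝ} {q : ℕ} {x u : ℕ → X} {y : ℕ → X →L[𝕜] 𝕜}
    (h : IsSystem C x y fun _ a => lnorm p a) (hp : 0 < p) (hδ : 0 < δ) (hB : 0 ≤ B) (hD : 0 ≤ D)
    (hyu : ∀ k, δ ≤ ‖y k (u k)‖)
    (hup : ∀ N : ℕ, 1 ≤ N → signAvg (fun ε : Fin N → ℤˣ => ‖signSum ε fun k : Fin N => u k‖) ≤
      B * (N : ℝ) ^ θ)
    (hlow : ∀ N : ℕ, 1 ≤ N → ∑ k : Fin N, ‖u k‖ ^ q ≤ B * (N : ℝ) ^ (1 - θ) *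
      (signAvg (fun ε : Fin N → ℤˣ => ‖signSum ε fun k : Fin N => x k‖) + D)) :
    1 / p = θ := by
  have hC : 0 ≤ C := (norm_nonneg _).trans (h.norm_vec_le 0)
  have hu0 : ∀ k, δ ≤ C * ‖u k‖ := fun k =>
    (hyu k).trans (((y k).le_opNorm (u k)).trans (by gcongr; exact h.norm_dual_le k))
  have hCpos : 0 < C := by
    by_contra hcon
    nlinarith [norm_nonneg (u 0), hu0 0]
  apply le_antisymm
  · refine le_of_forall_mul_rpow_le (c := δ) (B := C * B) hδ fun N hN => ?_
    have h1 := h.le_signAvg N fun k : Fin N => u k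
    have h2 : δ * lnorm p (fun _ : Fin N => (1 : 𝕜)) ≤ lnorm p (fun k : Fin N => y k (u k)) :=
      lnorm_le_rpow_sum_mul hp hδ.le _ fun k => by simpa using hyu k
    rw [lnorm_const] at h2
    have h3 := mul_le_mul_of_nonneg_left (hup N hN) hC
    linarith
  · have key : ∀ N : ℕ, 1 ≤ N →
        (δ / C) ^ q * (N : ℝ) ^ (1 : ℝ) ≤ (B * (C + D)) * (N : ℝ) ^ (1 - θ + 1 / p) := by
      intro N hN
      have hN' : (1 : ℝ) ≤ N := by exact_mod_cast hN
      have h1 : (N : ℝ) * (δ / C) ^ q ≤ ∑ k : Fin N, ‖u k‖ ^ q := by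
        have : ∀ k : Fin N, (δ / C) ^ q ≤ ‖u k‖ ^ q := fun k =>
          pow_le_pow_left₀ (by positivity) ((div_le_iff₀' hCpos).2 (hu0 k)) q
        simpa using Finset.sum_le_sum fun k (_ : k ∈ Finset.univ) => this k
      have h2 : signAvg (fun ε : Fin N → ℤˣ => ‖signSum ε fun k : Fin N => x k‖) ≤
          C * (N : ℝ) ^ (1 / p) := by
        refine signAvg_le fun ε => ?_
        have := h.norm_signSum_le N (fun _ => 1) ε
        simpa only [one_smul, lnorm_const] using this
      have h3 : D ≤ D * (N : ℝ) ^ (1 / p) :=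
        le_mul_of_one_le_right hD (Real.one_le_rpow hN' (by positivity))
      rw [Real.rpow_one, Real.rpow_add (by linarith)]
      calc (δ / C) ^ q * N ≤ _ := by linarith
        _ ≤ _ := hlow N hN
        _ ≤ B * (N : ℝ) ^ (1 - θ) * (C * (N : ℝ) ^ (1 / p) + D * (N : ℝ) ^ (1 / p)) := by
          gcongr
        _ = _ := by ring
    have := le_of_forall_mul_rpow_le (by positivity) key
    linarith

end Exponent

/-! ### Estimates in the inner space L_r -/

section Inner

variable {𝕜 : Type*} [RCLike 𝕜] {β : Type*} {mβ : MeasurableSpace β} {ν : Measure β}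
  [IsProbabilityMeasure ν] {r : ℝ≥0∞} [Fact (1 ≤ r)]

/-- Pointwise upper Khintchine: values bounded by M have square function at most M√N. -/
lemma exists_sum_norm_signSum_pow_le {q : ℕ} (hq : r ≤ q) : ∃ B : ℝ, 0 < B ∧
    ∀ (N : ℕ) (M : ℝ) (v : Fin N → Lp 𝕜 r ν), 1 ≤ N → 0 < M →
      (∀ k, ∀ᵐ ω ∂ν, ‖v k ω‖ ≤ M) →
      ∑ ε : Fin N → ℤˣ, ‖signSum ε v‖ ^ q ≤ 2 ^ N * (B * (M * √N) ^ q) := by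
  obtain ⟨B, hB, h⟩ := exists_signAvg_norm_pow_le 𝕜 q
  refine ⟨B, hB, fun N M v hN hM hv => sum_norm_pow_le hq (by positivity) ?_⟩
  filter_upwards [ae_all_iff.2 hv, ae_all_iff.2 fun ε => coeFn_signSum ε v] with ω h1 h2
  simp only [h2]
  have hN' : (0 : ℝ) < N := by exact_mod_cast hN
  have h3 := h N (fun k => v k ω) (M * √N) (by positivity) (by
    calc ∑ k, ‖v k ω‖ ^ 2 ≤ ∑ _k : Fin N, M ^ 2 :=
          Finset.sum_le_sum fun k _ => pow_le_pow_left₀ (norm_nonneg _) (h1 k) 2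
      _ = _ := by rw [mul_pow, Real.sq_sqrt hN'.le]; simp [mul_comm])
  rw [signAvg, inv_mul_le_iff₀ (by positivity)] at h3
  exact h3

/-- With S = ∑ |v_k|² pointwise, ∑ |v_k|^q ≤ M^{q-2} S. One factor √S is at most M√N; the other is
bounded by the sign average of w through lower Khintchine. The result is linear in the sign average,
so it can be integrated. -/
lemma exists_sum_norm_pow_le_sum_signSum {q : ℕ} (hq : r ≤ q) (hq2 : 2 ≤ q) : ∃ B : ℝ, 0 < B ∧
    ∀ (N : ℕ) (M : ℝ) (v w : Fin N → Lp 𝕜 r ν), 0 < M →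
      (∀ k, ∀ᵐ ω ∂ν, ‖v k ω‖ ≤ M) → (∀ k, ∀ᵐ ω ∂ν, ‖v k ω‖ ≤ ‖w k ω‖) →
      ∑ k, ‖v k‖ ^ q ≤ B * M ^ (q - 1) * √N * ((2 ^ N)⁻¹ * ∑ ε, ‖signSum ε w‖) := by
  obtain ⟨c, hc, h⟩ := exists_le_signAvg_norm 𝕜
  refine ⟨c⁻¹, by positivity, fun N M v w hM hv hvw => ?_⟩
  have key := sum_norm_pow_le_sum hq (u := v) (g := fun ε : Fin N → ℤˣ => signSum ε w)
    (b := c⁻¹ * M ^ (q - 1) * √N * (2 ^ N)⁻¹) (d := 0) (by positivity) le_rfl (by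
      filter_upwards [ae_all_iff.2 hv, ae_all_iff.2 hvw,
        ae_all_iff.2 fun ε => coeFn_signSum ε w] with ω h1 h2 h3
      simp only [h3, add_zero]
      have h4 := h N (fun k => w k ω)
      rw [signAvg] at h4
      set S := ∑ k, ‖v k ω‖ ^ 2 with hS
      have hS0 : 0 ≤ S := by positivity
      have h5 : √S ≤ √(∑ k, ‖w k ω‖ ^ 2) := Real.sqrt_le_sqrt
        (Finset.sum_le_sum fun k _ => pow_le_pow_left₀ (norm_nonneg _) (h2 k) 2)
      have h6 : √S ≤ M * √N := by
        rw [Real.sqrt_le_left (by positivity), mul_pow, Real.sq_sqrt (by positivity)]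
        calc S ≤ ∑ _k : Fin N, M ^ 2 :=
              Finset.sum_le_sum fun k _ => pow_le_pow_left₀ (norm_nonneg _) (h1 k) 2
          _ = _ := by simp [mul_comm]
      have h7 : ∑ k, ‖v k ω‖ ^ q ≤ M ^ (q - 2) * S := by
        rw [hS, Finset.mul_sum]
        refine Finset.sum_le_sum fun k _ => ?_
        calc ‖v k ω‖ ^ q = ‖v k ω‖ ^ (q - 2) * ‖v k ω‖ ^ 2 := by
              rw [← pow_add]; congr 1; omega
          _ ≤ _ := by gcongr; exact h1 k
      have h8 : √S ≤ c⁻¹ * ((2 ^ N)⁻¹ * ∑ ε : Fin N → ℤˣ, ‖signSum ε fun k => w k ω‖) := by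
        rw [le_inv_mul_iff₀ hc]
        exact le_trans (by gcongr) h4
      calc _ ≤ _ := h7
        _ = M ^ (q - 2) * (√S * √S) := by rw [Real.mul_self_sqrt hS0]
        _ ≤ M ^ (q - 2) * (M * √N *
            (c⁻¹ * ((2 ^ N)⁻¹ * ∑ ε : Fin N → ℤˣ, ‖signSum ε fun k => w k ω‖))) := by gcongr
        _ = _ := by
          have : M ^ (q - 1) = M ^ (q - 2) * M := by
            rw [← pow_succ]; congr 1; omega
          rw [this]; ring)
  linarith

variable {K L : ℕ → ℕ} {M : ℝ}

lemma norm_signSum_slice_le (hr : r ≠ ∞) (hKL : ∀ k, K k ≤ L k)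
    (hK : ∀ k, 2 ^ k * ∑ j ∈ Finset.range k, L j ≤ K k) {N : ℕ} (hN : 1 ≤ N) (hM : 0 ≤ M)
    {x u : Fin N → Lp 𝕜 r ν} (hx : ∀ k, ‖x k‖ ≤ M)
    (hu : ∀ k, u k =ᵐ[ν] fun ω => slice (K k) (L k) (x k ω)) (ε : Fin N → ℤˣ) :
    ‖signSum ε u‖ ≤ 3 * M * (N : ℝ) ^ (1 / r.toReal) := by
  have hr0 : 0 < r.toReal := toReal_pos_of_one_le hr
  have h1 := norm_sum_slice_le hr hKL hK (a := fun _ => 1) (A := 1) (fun _ => zero_le_one)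
    (fun _ => le_rfl) zero_le_one (w := fun k => (ε k : ℤ) • u k) hu fun k => by
      rcases Int.units_eq_one_or (ε k) with h | h
      · simp [h]
      · filter_upwards [Lp.coeFn_neg (u k)] with ω hω
        have : ((ε k : ℤ) • u k : Lp 𝕜 r ν) = -u k := by simp [h]
        rw [this, hω]; simp
  have h2 : (∑ k : Fin N, (1 * ‖x k‖) ^ r.toReal) ^ (1 / r.toReal) ≤
      M * lnorm r.toReal (fun _ : Fin N => (1 : 𝕜)) :=
    rpow_sum_mul_le_lnorm hr0 hM _ (fun k => by positivity) fun k => by simpa using hx k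
  rw [lnorm_const] at h2
  have h3 := sum_half_pow_mul_le hM hx
  have h4 : M ≤ M * (N : ℝ) ^ (1 / r.toReal) := le_mul_of_one_le_right hM
    (Real.one_le_rpow (by exact_mod_cast hN) (by positivity))
  have h5 : signSum ε u = ∑ k, (ε k : ℤ) • u k := rfl
  rw [h5]
  linarith

/-- As ‖u_k‖ ≤ M, q-th powers reduce to first powers at the cost of M^{q-1}. Hölder passes from ℓ_1
to ℓ_r with factor N^{1-1/r}, and the lower slice estimate bounds the ℓ_r-norm. -/
lemma sum_norm_slice_pow_le (hr : r ≠ ∞) (hKL : ∀ k, K k ≤ L k)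
    (hK : ∀ k, 2 ^ k * ∑ j ∈ Finset.range k, L j ≤ K k) {N : ℕ} (hN : 1 ≤ N) (hM : 0 ≤ M)
    {q : ℕ} (hq : 1 ≤ q) {x u w : Fin N → Lp 𝕜 r ν} (hx : ∀ k, ‖x k‖ ≤ M)
    (hu : ∀ k, u k =ᵐ[ν] fun ω => slice (K k) (L k) (x k ω))
    (hw : ∀ k, ∀ᵐ ω ∂ν, ‖x k ω‖ ≤ ‖w k ω‖) :
    ∑ k, ‖u k‖ ^ q ≤ M ^ (q - 1) * (N : ℝ) ^ (1 - 1 / r.toReal) *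
      (signAvg (fun ε => ‖signSum ε w‖) + 2 * M) := by
  have hr0 : 0 < r.toReal := toReal_pos_of_one_le hr
  have hr1 := one_le_toReal hr
  have hN' : (0 : ℝ) < N := by exact_mod_cast hN
  have h1 := rpow_sum_slice_le hr hKL hK (a := fun _ => 1) (A := 1) (fun _ => zero_le_one)
    (fun _ => le_rfl) zero_le_one (w := w) hu fun k => by simpa using hw k
  have h3 := sum_half_pow_mul_le hM hx
  have huM : ∀ k, ‖u k‖ ≤ M := fun k => by
    refine (Lp.norm_le_norm_of_ae_le ?_).trans (hx k)
    filter_upwards [hu k] with ω h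
    rw [h]
    exact (norm_slice_le_norm_clamp (hKL k) _).trans (norm_clamp_le _ _)
  have h4 : ∑ k, ‖u k‖ ^ q ≤ M ^ (q - 1) * ∑ k, ‖u k‖ := by
    rw [Finset.mul_sum]
    refine Finset.sum_le_sum fun k _ => ?_
    calc ‖u k‖ ^ q = ‖u k‖ ^ (q - 1) * ‖u k‖ := by rw [← pow_succ]; congr 1; omega
      _ ≤ _ := by gcongr; exact huM k
  have h5 : ∑ k, ‖u k‖ ≤ (N : ℝ) ^ (1 - 1 / r.toReal) *
      (∑ k, (1 * ‖u k‖) ^ r.toReal) ^ (1 / r.toReal) := by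
    have h6 := Real.rpow_sum_le_const_mul_sum_rpow_of_nonneg Finset.univ hr1
      (f := fun k => ‖u k‖) fun k _ => norm_nonneg _
    have h7 := Real.rpow_le_rpow (by positivity) h6 (by positivity : 0 ≤ 1 / r.toReal)
    rw [← Real.rpow_mul (by positivity), mul_one_div_cancel hr0.ne', Real.rpow_one,
      Real.mul_rpow (by positivity) (by positivity), ← Real.rpow_mul (by positivity)] at h7
    have h8 : (r.toReal - 1) * (1 / r.toReal) = 1 - 1 / r.toReal := by field_simp
    rw [h8] at h7
    simpa using h7
  calc _ ≤ _ := h4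
    _ ≤ M ^ (q - 1) * ((N : ℝ) ^ (1 - 1 / r.toReal) *
        (signAvg (fun ε => ‖signSum ε w‖) + 2 * M)) := by
      gcongr
      refine h5.trans ?_
      gcongr
      linarith
    _ = _ := by ring

end Inner

/-! ### Systems in L_s(L_r) -/

section Mixed

variable {𝕜 : Type*} [RCLike 𝕜] {α β : Type*} {mα : MeasurableSpace α} {μ : Measure α}
  [IsProbabilityMeasure μ] {mβ : MeasurableSpace β} {ν : Measure β} [IsProbabilityMeasure ν]
  {r s : ℝ≥0∞} [Fact (1 ≤ r)] [Fact (1 ≤ s)]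

lemma signAvg_norm_le_of_pow {E : Type*} [NormedAddCommGroup E] {q : ℕ} (hq : s ≤ q) {N : ℕ}
    {B : ℝ} (hB : 0 ≤ B) {u : Fin N → Lp E s μ}
    (h : ∀ᵐ ω ∂μ, ∑ ε : Fin N → ℤˣ, ‖signSum ε fun k => u k ω‖ ^ q ≤ 2 ^ N * B ^ q) :
    signAvg (fun ε => ‖signSum ε u‖) ≤ B := by
  have hq0 : q ≠ 0 := by
    rintro rfl
    have := (Fact.out : 1 ≤ s).trans hq
    simp at this
  have h1 := sum_norm_pow_le hq (g := fun ε : Fin N → ℤˣ => signSum ε u)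
    (B := 2 ^ N * B ^ q) (by positivity) (by
      filter_upwards [h, ae_all_iff.2 fun ε => coeFn_signSum ε u] with ω h1 h2
      simpa only [h2] using h1)
  rw [← inv_mul_le_iff₀ (by positivity)] at h1
  exact le_of_pow_le_pow_left₀ hq0 hB ((signAvg_pow_le (fun _ => norm_nonneg _) q).trans h1)

lemma sum_norm_pow_le_signAvg {E F : Type*} [NormedAddCommGroup E] [NormedAddCommGroup F] {q : ℕ}
    (hq : s ≤ q) {N : ℕ} {B D : ℝ} (hB : 0 ≤ B) (hD : 0 ≤ D) {u : Fin N → Lp E s μ}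
    {x : Fin N → Lp F s μ}
    (h : ∀ᵐ ω ∂μ, ∑ k, ‖u k ω‖ ^ q ≤ B * (signAvg (fun ε => ‖signSum ε fun k => x k ω‖) + D)) :
    ∑ k, ‖u k‖ ^ q ≤ B * (signAvg (fun ε => ‖signSum ε x‖) + D) := by
  have h1 := sum_norm_pow_le_sum hq (u := u) (g := fun ε : Fin N → ℤˣ => signSum ε x)
    (b := B * (2 ^ N)⁻¹) (d := B * D) (by positivity) (by positivity) (by
      filter_upwards [h, ae_all_iff.2 fun ε => coeFn_signSum ε x] with ω h1 h2
      simp only [h2]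
      rw [signAvg] at h1
      linarith)
  rw [signAvg]
  linarith

/-- The truncation in the inner variable. -/
noncomputable def innerClamp (K : ℕ) (v : Lp 𝕜 r ν) : Lp 𝕜 r ν :=
  (lipschitzWith_clamp K).compLp (clamp_zero K) v

lemma lipschitzWith_innerClamp (K : ℕ) :
    LipschitzWith 2 (innerClamp K : Lp 𝕜 r ν → Lp 𝕜 r ν) :=
  (lipschitzWith_clamp K).lipschitzWith_compLp (clamp_zero K)

lemma innerClamp_zero (K : ℕ) : innerClamp K (0 : Lp 𝕜 r ν) = 0 :=
  LipschitzWith.compLp_zero _ _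

lemma coeFn_innerClamp (K : ℕ) (v : Lp 𝕜 r ν) :
    innerClamp K v =ᵐ[ν] fun ω => clamp K (v ω) :=
  LipschitzWith.coeFn_compLp _ _ v

lemma tendsto_innerClamp (hr : r ≠ ∞) (v : Lp 𝕜 r ν) :
    Tendsto (fun K => innerClamp K v) atTop (𝓝 v) :=
  tendsto_compLp lipschitzWith_clamp clamp_zero tendsto_clamp hr v

/-- A system of `ℓ_p` in `L_s(L_r)` which is large on uniformly bounded functions: `p = 2`. -/
lemma IsSystem.eq_two_of_bounded (hr : r ≠ ∞) (hs : s ≠ ∞) {C p δ M : ℝ} (hp : 0 < p)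
    {x u : ℕ → Lp (Lp 𝕜 r ν) s μ} {y : ℕ → Lp (Lp 𝕜 r ν) s μ →L[𝕜] 𝕜}
    (h : IsSystem C x y fun _ a => lnorm p a) (hδ : 0 < δ) (hM : 0 < M)
    (huM : ∀ k, ∀ᵐ ω ∂μ, ∀ᵐ η ∂ν, ‖u k ω η‖ ≤ M)
    (hux : ∀ k, ∀ᵐ ω ∂μ, ∀ᵐ η ∂ν, ‖u k ω η‖ ≤ ‖x k ω η‖)
    (hyu : ∀ k, δ ≤ ‖y k (u k)‖) : p = 2 := by
  obtain ⟨q, hq⟩ : ∃ q : ℕ, max (max r s) 2 ≤ q := by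
    obtain ⟨q, hq⟩ := ENNReal.exists_nat_gt (r := max (max r s) 2) (by finiteness)
    exact ⟨q, hq.le⟩
  have hqr : r ≤ q := ((le_max_left _ _).trans (le_max_left _ _)).trans hq
  have hqs : s ≤ q := ((le_max_right _ _).trans (le_max_left _ _)).trans hq
  have hq2 : 2 ≤ q := by exact_mod_cast (le_max_right _ _).trans hq
  obtain ⟨B₁, hB₁, h₁⟩ := exists_sum_norm_signSum_pow_le (𝕜 := 𝕜) (ν := ν) hqr
  obtain ⟨B₂, hB₂, h₂⟩ := exists_sum_norm_pow_le_sum_signSum (𝕜 := 𝕜) (ν := ν) hqr hq2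
  -- Adding 1 makes the base at least 1, so that B₁ ≤ (B₁ + 1)^q and the constant can be moved
  -- inside the q-th power.
  set B := max ((B₁ + 1) * M) (B₂ * M ^ (q - 1)) with hB
  have hB0 : 0 ≤ B := le_trans (by positivity) (le_max_left _ _)
  have hhalf : ∀ N : ℕ, √(N : ℝ) = (N : ℝ) ^ (1 / 2 : ℝ) := fun N => Real.sqrt_eq_rpow _
  have := h.exponent_eq (θ := 1 / 2) (B := B) (D := 0) (q := q) hp hδ hB0 le_rfl hyu
    (fun N hN => by
      have hpos : 0 ≤ (B₁ + 1) * (M * √N) := by positivity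
      refine (signAvg_norm_le_of_pow hqs hpos ?_).trans ?_
      · filter_upwards [ae_all_iff.2 fun k : Fin N => huM k] with ω h3
        refine (h₁ N M (fun k => u k ω) hN hM h3).trans ?_
        rw [mul_pow (B₁ + 1)]
        gcongr
        exact (by linarith : B₁ ≤ B₁ + 1).trans (le_self_pow₀ (by linarith) (by omega))
      · rw [← hhalf, ← mul_assoc]
        gcongr
        exact le_max_left _ _)
    (fun N hN => by
      have hcalc : (1 : ℝ) - 1 / 2 = 1 / 2 := by norm_num
      rw [hcalc, ← hhalf]
      refine sum_norm_pow_le_signAvg hqs (by positivity) le_rfl ?_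
      filter_upwards [ae_all_iff.2 fun k : Fin N => huM k,
        ae_all_iff.2 fun k : Fin N => hux k] with ω h3 h4
      refine (h₂ N M (fun k => u k ω) (fun k => x k ω) hM h3 h4).trans ?_
      rw [add_zero, signAvg]
      gcongr
      exact le_max_right _ _)
  field_simp at this
  linarith

/-- A system of `ℓ_p` in `L_s(L_r)` which is large on slices in the inner variable of functions with
bounded inner norms: `p = r`. -/
lemma IsSystem.eq_of_inner_slices (hr : r ≠ ∞) (hs : s ≠ ∞) {C p δ M : ℝ} (hp : 0 < p)
    {x v u : ℕ → Lp (Lp 𝕜 r ν) s μ} {y : ℕ → Lp (Lp 𝕜 r ν) s μ →L[𝕜] 𝕜}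
    (h : IsSystem C x y fun _ a => lnorm p a) (hδ : 0 < δ) (hM : 0 ≤ M)
    {K L : ℕ → ℕ} (hKL : ∀ k, K k ≤ L k)
    (hK : ∀ k, 2 ^ k * ∑ j ∈ Finset.range k, L j ≤ K k)
    (hvM : ∀ k, ∀ᵐ ω ∂μ, ‖v k ω‖ ≤ M)
    (hvx : ∀ k, ∀ᵐ ω ∂μ, ∀ᵐ η ∂ν, ‖v k ω η‖ ≤ ‖x k ω η‖)
    (huv : ∀ k, ∀ᵐ ω ∂μ, u k ω =ᵐ[ν] fun η => slice (K k) (L k) (v k ω η))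
    (hyu : ∀ k, δ ≤ ‖y k (u k)‖) : p = r.toReal := by
  obtain ⟨q, hq⟩ : ∃ q : ℕ, s ≤ q := by
    obtain ⟨q, hq⟩ := ENNReal.exists_nat_gt hs
    exact ⟨q, hq.le⟩
  have hq1 : 1 ≤ q := by exact_mod_cast (Fact.out : 1 ≤ s).trans hq
  have hr0 : 0 < r.toReal := toReal_pos_of_one_le hr
  set B := max (3 * M) (M ^ (q - 1)) with hB
  have hB0 : 0 ≤ B := le_trans (by positivity) (le_max_left _ _)
  have := h.exponent_eq (θ := 1 / r.toReal) (B := B) (D := 2 * M) (q := q) hp hδ hB0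
    (by positivity) hyu
    (fun N hN => by
      refine (signAvg_norm_le_of_pow (B := 3 * M * (N : ℝ) ^ (1 / r.toReal)) hq
        (by positivity) ?_).trans ?_
      · filter_upwards [ae_all_iff.2 fun k : Fin N => hvM k,
          ae_all_iff.2 fun k : Fin N => huv k] with ω h3 h4
        have h5 : ∀ ε : Fin N → ℤˣ, ‖signSum ε fun k : Fin N => u k ω‖ ^ q ≤
            (3 * M * (N : ℝ) ^ (1 / r.toReal)) ^ q := fun ε =>
          pow_le_pow_left₀ (norm_nonneg _)
            (norm_signSum_slice_le hr hKL hK hN hM (x := fun k : Fin N => v k ω) h3 h4 ε) q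
        simpa using Finset.sum_le_sum fun ε (_ : ε ∈ Finset.univ) => h5 ε
      · gcongr
        exact le_max_left _ _)
    (fun N hN => by
      refine sum_norm_pow_le_signAvg hq (by positivity) (by positivity) ?_
      filter_upwards [ae_all_iff.2 fun k : Fin N => hvM k, ae_all_iff.2 fun k : Fin N => huv k,
        ae_all_iff.2 fun k : Fin N => hvx k] with ω h3 h4 h5
      refine (sum_norm_slice_pow_le hr hKL hK hN hM hq1 (x := fun k : Fin N => v k ω)
        (u := fun k : Fin N => u k ω) (w := fun k : Fin N => x k ω) h3 h4 h5).trans ?_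
      have : 0 ≤ signAvg (fun ε : Fin N → ℤˣ => ‖signSum ε fun k : Fin N => x k ω‖) :=
        signAvg_nonneg fun _ => norm_nonneg _
      gcongr
      exact le_max_right _ _)
  field_simp at this
  linarith

/-- A system of `ℓ_p` in `L_s(L_r)` which is large on truncations in the outer variable:
`p ∈ {2, r}`. -/
lemma eq_two_or_eq_of_outer_truncations (hr : r ≠ ∞) (hs : s ≠ ∞) {C p δ : ℝ} (hp : 0 < p)
    {x : ℕ → Lp (Lp 𝕜 r ν) s μ} {y : ℕ → Lp (Lp 𝕜 r ν) s μ →L[𝕜] 𝕜}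
    (h : ∀ σ : ℕ → ℕ, StrictMono σ →
      IsSystem C (fun k => x (σ k)) (fun k => y (σ k)) fun _ a => lnorm p a)
    (hδ : 0 < δ) (K₀ : ℕ)
    (hy : ∃ᶠ n in atTop, δ ≤
      ‖y n ((lipschitzWith_clamp K₀).compLp (clamp_zero K₀) (x n))‖) :
    p = 2 ∨ p = r.toReal := by
  set v : ℕ → Lp (Lp 𝕜 r ν) s μ := fun n => (lipschitzWith_clamp K₀).compLp (clamp_zero K₀) (x n)
    with hv
  have hvc : ∀ n, ∀ᵐ ω ∂μ, v n ω = clamp K₀ (x n ω) := fun n => LipschitzWith.coeFn_compLp _ _ _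
  have hvx : ∀ n, ∀ᵐ ω ∂μ, ∀ᵐ η ∂ν, ‖v n ω η‖ ≤ ‖x n ω η‖ := fun n => by
    filter_upwards [hvc n] with ω h1
    rw [h1, clamp]
    filter_upwards [Lp.coeFn_smul (min 1 ((K₀ : ℝ) / ‖x n ω‖)) (x n ω)] with η h2
    rw [h2, Pi.smul_apply, norm_smul, Real.norm_of_nonneg (by positivity)]
    exact mul_le_of_le_one_left (norm_nonneg _) (min_le_left _ _)
  have hvM : ∀ n, ∀ᵐ ω ∂μ, ‖v n ω‖ ≤ K₀ := fun n => by
    filter_upwards [hvc n] with ω h1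
    rw [h1]
    exact norm_clamp_le_level _ _
  set T : ℕ → Lp (Lp 𝕜 r ν) s μ → Lp (Lp 𝕜 r ν) s μ := fun M =>
    (lipschitzWith_innerClamp M).compLp (innerClamp_zero M) with hT
  have hTc : ∀ M z, ∀ᵐ ω ∂μ, T M z ω =ᵐ[ν] fun η => clamp M (z ω η) := fun M z => by
    filter_upwards [(lipschitzWith_innerClamp M).coeFn_compLp (innerClamp_zero M) z] with ω h1
    rw [hT, h1]
    exact coeFn_innerClamp M (z ω)
  -- Either inner truncations become invisible to the functionals, so inner slices carry them, or
  -- some fixed truncation level M is seen infinitely often.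
  by_cases hsmall : ∀ M, ∀ δ' > 0, ∀ᶠ n in atTop, ‖y n (T M (v n))‖ < δ'
  · right
    obtain ⟨σ, K, L, hσ, hKL, hK, hyu⟩ := exists_slices (T := T)
      (tendsto_compLp lipschitzWith_innerClamp innerClamp_zero (tendsto_innerClamp hr) hs)
      (x := fun _ => v) (y := fun _ => y) hδ (fun _ => hy) fun _ => hsmall
    refine (h σ hσ).eq_of_inner_slices hr hs hp (half_pos hδ) K₀.cast_nonneg hKL hK
      (v := fun k => v (σ k)) (u := fun k => T (L k) (v (σ k)) - T (K k) (v (σ k)))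
      (fun k => hvM _) (fun k => hvx _) (fun k => ?_) hyu
    filter_upwards [hTc (L k) (v (σ k)), hTc (K k) (v (σ k)),
      Lp.coeFn_sub (T (L k) (v (σ k))) (T (K k) (v (σ k)))] with ω h1 h2 h3
    rw [h3, Pi.sub_apply]
    filter_upwards [h1, h2, Lp.coeFn_sub (T (L k) (v (σ k)) ω) (T (K k) (v (σ k)) ω)]
      with η h4 h5 h6
    rw [h6, Pi.sub_apply, h4, h5, slice]
  · left
    push Not at hsmall
    obtain ⟨M, δ', hδ', hfreq⟩ := hsmall
    obtain ⟨σ, hσ, hyσ⟩ := extraction_of_frequently_atTop hfreq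
    -- The level M may be 0, while the bound has to be positive; hence M + 1.
    refine (h σ hσ).eq_two_of_bounded hr hs hp hδ' (M := M + 1) (by positivity)
      (u := fun k => T M (v (σ k))) (fun k => ?_) (fun k => ?_) hyσ
    · filter_upwards [hTc M (v (σ k))] with ω h1
      filter_upwards [h1] with η h2
      rw [h2]
      exact (norm_clamp_le_level _ _).trans (by linarith)
    · filter_upwards [hTc M (v (σ k)), hvx (σ k)] with ω h1 h3
      filter_upwards [h1, h3] with η h2 h4
      rw [h2]
      exact (norm_clamp_le _ _).trans h4

end Mixed

/-! ### Unit vectors and coordinates of U(ℓ_p) -/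

namespace FnSpace

variable {I : Type*} {ρ : FunctionNorm I} {X : Type*} [NormedAddCommGroup X]

lemma norm_le_norm_of_le {Y : Type*} [NormedAddCommGroup Y] {f : FnSpace ρ X} {g : FnSpace ρ Y}
    (h : ∀ i, ‖f i‖ ≤ ‖g i‖) : ‖f‖ ≤ ‖g‖ :=
  ENNReal.toReal_mono (enorm_ne_top g) (ρ.mono' _ _ fun i => h i)

lemma coe_sum {ι : Type*} (S : Finset ι) (f : ι → FnSpace ρ X) (i : I) :
    (∑ k ∈ S, f k : FnSpace ρ X) i = ∑ k ∈ S, f k i := by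
  classical
  induction S using Finset.induction_on with
  | empty => simp
  | insert k S hk ih => rw [Finset.sum_insert hk, Finset.sum_insert hk, coe_add, Pi.add_apply, ih]

variable [DecidableEq I]

lemma toFun_nnnorm_single (hρ : ρ.IsSequenceNorm) (i : I) (v : X) :
    ρ.toFun (fun j => ‖(Pi.single i v : I → X) j‖₊) = ‖v‖₊ := by
  have h : (fun j => ‖(Pi.single i v : I → X) j‖₊) = ‖v‖₊ • (({i} : Set I).indicator 1) := by
    ext j
    by_cases hj : j = i
    · subst hj; simp
    · simp [hj]
  rw [h, ρ.smul', hρ i, mul_one]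

/-- The function with value `v` at `i` and zero elsewhere. -/
def single (hρ : ρ.IsSequenceNorm) (i : I) (v : X) : FnSpace ρ X :=
  ⟨Pi.single i v, by
    change ρ.toFun (fun j => ‖(Pi.single i v : I → X) j‖₊) < ∞
    rw [toFun_nnnorm_single hρ]
    exact ENNReal.coe_lt_top⟩

lemma coe_single (hρ : ρ.IsSequenceNorm) (i : I) (v : X) :
    (single hρ i v : I → X) = Pi.single i v := rfl

lemma norm_single (hρ : ρ.IsSequenceNorm) (i : I) (v : X) : ‖single hρ i v‖ = ‖v‖ := by
  rw [norm_def, coe_single, toFun_nnnorm_single hρ]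
  simp

lemma norm_apply_le (hρ : ρ.IsSequenceNorm) (f : FnSpace ρ X) (i : I) : ‖f i‖ ≤ ‖f‖ := by
  rw [← norm_single hρ i (f i)]
  refine norm_le_norm_of_le fun j => ?_
  rw [coe_single]
  by_cases hj : j = i
  · subst hj; simp
  · simp [hj]

end FnSpace

section UnitVectors

variable {I : Type*} [DecidableEq I] {ρ : FunctionNorm I} (hρ : ρ.IsSequenceNorm)
  {𝕜 : Type*} [RCLike 𝕜] {p : ℝ≥0∞} [Fact (1 ≤ p)]

/-- The unit vectors of `L_ρ(ℓ_p)`. -/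
noncomputable def unitVec (𝕜 : Type*) [RCLike 𝕜] (p : ℝ≥0∞) [Fact (1 ≤ p)] (i : I) (n : ℕ) :
    FnSpace ρ (lp (fun _ : ℕ => 𝕜) p) :=
  FnSpace.single hρ i (lp.single p n 1)

lemma norm_unitVec (i : I) (n : ℕ) : ‖unitVec hρ 𝕜 p i n‖ = 1 := by
  rw [unitVec, FnSpace.norm_single, lp.norm_single (zero_lt_one.trans_le Fact.out), norm_one]

lemma unitVec_apply (i j : I) (n m : ℕ) :
    (unitVec hρ 𝕜 p i n j : ∀ _ : ℕ, 𝕜) m = if (i, n) = (j, m) then 1 else 0 := by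
  rw [unitVec, FnSpace.coe_single]
  by_cases hj : i = j
  · subst hj
    by_cases hm : n = m
    · subst hm; simp
    · simp [hm, Ne.symm hm]
  · simp [hj, Ne.symm hj]

/-- The coordinate functionals of `L_ρ(ℓ_p)`. -/
noncomputable def coordFun (hρ : ρ.IsSequenceNorm) (𝕜 : Type*) [RCLike 𝕜] (p : ℝ≥0∞)
    [Fact (1 ≤ p)] (i : I) (n : ℕ) : FnSpace ρ (lp (fun _ : ℕ => 𝕜) p) →L[𝕜] 𝕜 :=
  LinearMap.mkContinuous
    { toFun := fun f => (f i : ∀ _ : ℕ, 𝕜) n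
      map_add' := fun f g => by simp
      map_smul' := fun c f => by simp } 1 fun f => by
    rw [one_mul]
    exact (lp.norm_apply_le_norm one_le_ne_zero (f i) n).trans (FnSpace.norm_apply_le hρ f i)

lemma coordFun_apply (i : I) (n : ℕ) (f : FnSpace ρ (lp (fun _ : ℕ => 𝕜) p)) :
    coordFun hρ 𝕜 p i n f = (f i : ∀ _ : ℕ, 𝕜) n := rfl

lemma norm_coordFun_le (i : I) (n : ℕ) : ‖coordFun hρ 𝕜 p i n‖ ≤ 1 :=
  LinearMap.mkContinuous_norm_le _ zero_le_one _

variable {N : ℕ} {ι : Fin N → I} {n : Fin N → ℕ}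

lemma sum_smul_unitVec_apply (c : Fin N → 𝕜) (i : I) (m : ℕ) :
    ((∑ k, c k • unitVec hρ 𝕜 p (ι k) (n k) : FnSpace ρ (lp (fun _ : ℕ => 𝕜) p)) i :
      ∀ _ : ℕ, 𝕜) m = ∑ k, if (ι k, n k) = (i, m) then c k else 0 := by
  rw [← coordFun_apply hρ, map_sum]
  refine Finset.sum_congr rfl fun k _ => ?_
  rw [map_smul, coordFun_apply, unitVec_apply, smul_eq_mul, mul_ite, mul_one, mul_zero]

lemma coordFun_sum_smul_unitVec (hinj : Function.Injective fun k => (ι k, n k)) (c : Fin N → 𝕜)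
    (k : Fin N) : coordFun hρ 𝕜 p (ι k) (n k) (∑ k, c k • unitVec hρ 𝕜 p (ι k) (n k)) = c k := by
  rw [coordFun_apply, sum_smul_unitVec_apply, Finset.sum_eq_single k]
  · simp
  · intro l _ hl
    exact if_neg fun h => hl (hinj h)
  · simp

/-- The unit vectors are 1-unconditional. -/
lemma norm_sum_smul_unitVec_le (hinj : Function.Injective fun k => (ι k, n k))
    {c : Fin N → 𝕜} {w : FnSpace ρ (lp (fun _ : ℕ => 𝕜) p)}
    (h : ∀ k, ‖c k‖ ≤ ‖coordFun hρ 𝕜 p (ι k) (n k) w‖) :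
    ‖∑ k, c k • unitVec hρ 𝕜 p (ι k) (n k)‖ ≤ ‖w‖ := by
  refine FnSpace.norm_le_norm_of_le fun i => lp.norm_mono one_le_ne_zero fun m => ?_
  by_cases hk : ∃ k, (ι k, n k) = (i, m)
  · obtain ⟨k, hk⟩ := hk
    obtain ⟨rfl, rfl⟩ := Prod.mk.inj hk
    rw [← coordFun_apply hρ, coordFun_sum_smul_unitVec hρ hinj, ← coordFun_apply hρ]
    exact h k
  · rw [sum_smul_unitVec_apply, Finset.sum_eq_zero fun k _ => if_neg fun h => hk ⟨k, h⟩]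
    simp

lemma norm_sum_smul_unitVec_same (hp : p ≠ ∞) (hn : Function.Injective n) (i : I)
    (c : Fin N → 𝕜) : ‖∑ k, c k • unitVec hρ 𝕜 p i (n k)‖ = lnorm p.toReal c := by
  have hp0 : 0 < p.toReal := toReal_pos_of_one_le hp
  have h1 : ∑ k, c k • unitVec hρ 𝕜 p i (n k) =
      FnSpace.single hρ i (∑ k, lp.single (E := fun _ : ℕ => 𝕜) p (n k) (c k)) := by
    refine Subtype.ext (funext fun j => ?_)
    refine (FnSpace.coe_sum _ _ j).trans ?_
    change ∑ k, (c k • unitVec hρ 𝕜 p i (n k) : FnSpace ρ (lp (fun _ : ℕ => 𝕜) p)) j =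
      (Pi.single i _ : I → lp (fun _ : ℕ => 𝕜) p) j
    by_cases hj : j = i
    · subst hj
      rw [Pi.single_eq_same]
      refine Finset.sum_congr rfl fun k _ => ?_
      rw [FnSpace.coe_smul, Pi.smul_apply, unitVec, FnSpace.coe_single, Pi.single_eq_same,
        ← lp.single_smul, smul_eq_mul, mul_one]
    · rw [Pi.single_eq_of_ne hj]
      refine Finset.sum_eq_zero fun k _ => ?_
      rw [FnSpace.coe_smul, Pi.smul_apply, unitVec, FnSpace.coe_single, Pi.single_eq_of_ne hj,
        smul_zero]
  have h2 : ∑ k, lp.single (E := fun _ : ℕ => 𝕜) p (n k) (c k) =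
      ∑ m ∈ Finset.univ.map ⟨n, hn⟩,
        lp.single (E := fun _ : ℕ => 𝕜) p m (Function.extend n c 0 m) := by
    rw [Finset.sum_map]
    exact Finset.sum_congr rfl fun k _ => by simp [hn.extend_apply]
  have h3 := lp.norm_sum_single hp0 (Function.extend n c 0) (Finset.univ.map ⟨n, hn⟩)
  rw [← h2, Finset.sum_map] at h3
  simp only [Function.Embedding.coeFn_mk, hn.extend_apply] at h3
  rw [h1, FnSpace.norm_single, lnorm, ← h3, ← Real.rpow_mul (norm_nonneg _),
    mul_one_div_cancel hp0.ne', Real.rpow_one]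

end UnitVectors

/-! ### The system defined by a complemented embedding -/

section Embedding

variable {I : Type*} [DecidableEq I] {ρ : FunctionNorm I} (hρ : ρ.IsSequenceNorm)
  {𝕜 : Type*} [RCLike 𝕜] {p : ℝ≥0∞} [Fact (1 ≤ p)] {X : Type*} [NormedAddCommGroup X]
  [NormedSpace 𝕜 X]

lemma isSystem_of_embedding (J : FnSpace ρ (lp (fun _ : ℕ => 𝕜) p) →L[𝕜] X)
    (P : X →L[𝕜] FnSpace ρ (lp (fun _ : ℕ => 𝕜) p)) {ι : ℕ → I} {n : ℕ → ℕ}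
    (hn : Function.Injective n) :
    IsSystem (‖J‖ + ‖P‖) (fun k => J (unitVec hρ 𝕜 p (ι k) (n k)))
      (fun k => (coordFun hρ 𝕜 p (ι k) (n k)).comp P)
      fun N a => ‖∑ k : Fin N, a k • unitVec hρ 𝕜 p (ι k) (n k)‖ where
  norm_signSum_le N a ε := by
    have hinj : Function.Injective fun k : Fin N => (ι k, n k) := fun k l h =>
      Fin.val_injective (hn (Prod.mk.inj h).2)
    have h1 : (signSum ε fun k : Fin N => a k • J (unitVec hρ 𝕜 p (ι k) (n k))) =
        J (∑ k : Fin N, (((ε k : ℤ) : 𝕜) * a k) • unitVec hρ 𝕜 p (ι k) (n k)) := by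
      rw [signSum, map_sum]
      refine Finset.sum_congr rfl fun k _ => ?_
      rw [map_smul, mul_smul, Int.cast_smul_eq_zsmul]
    rw [h1]
    refine (J.le_opNorm _).trans ?_
    gcongr
    · linarith [norm_nonneg P]
    · refine norm_sum_smul_unitVec_le hρ hinj fun k => ?_
      rw [coordFun_sum_smul_unitVec hρ hinj, ← smul_eq_mul, Int.cast_smul_eq_zsmul,
        norm_unit_zsmul]
  le_signAvg N z := by
    have hinj : Function.Injective fun k : Fin N => (ι k, n k) := fun k l h =>
      Fin.val_injective (hn (Prod.mk.inj h).2)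
    -- Diagonal averaging: in the average of w over all signs the cross terms y_k(z_l), l ≠ k,
    -- cancel, leaving ∑ y_k(z_k) e_k. Unconditionality bounds each w_ε by ‖P(∑ ε_k z_k)‖.
    set w : (Fin N → ℤˣ) → FnSpace ρ (lp (fun _ : ℕ => 𝕜) p) := fun ε =>
      ∑ k : Fin N, ((ε k : ℤ) • coordFun hρ 𝕜 p (ι k) (n k) (P (signSum ε z))) •
        unitVec hρ 𝕜 p (ι k) (n k) with hw
    have hwn : ∀ ε, ‖w ε‖ ≤ (‖J‖ + ‖P‖) * ‖signSum ε z‖ := fun ε => by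
      refine (norm_sum_smul_unitVec_le hρ hinj (w := P (signSum ε z)) fun k => ?_).trans
        ((P.le_opNorm _).trans ?_)
      · rw [norm_unit_zsmul]
      · gcongr
        linarith [norm_nonneg J]
    have hsum : ∑ ε, w ε = ((2 : 𝕜) ^ N) • ∑ k : Fin N,
        (coordFun hρ 𝕜 p (ι k) (n k) (P (z k))) • unitVec hρ 𝕜 p (ι k) (n k) := by
      rw [hw, Finset.sum_comm, Finset.smul_sum]
      refine Finset.sum_congr rfl fun k _ => ?_
      rw [← Finset.sum_smul, smul_smul]
      congr 1
      have := sum_sign_smul_signSum z k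
      have := congrArg (fun v => coordFun hρ 𝕜 p (ι k) (n k) (P v)) this
      simp only [map_sum, map_zsmul] at this
      rw [this]
      simp
    have h1 : 2 ^ N * ‖∑ k : Fin N,
        (coordFun hρ 𝕜 p (ι k) (n k) (P (z k))) • unitVec hρ 𝕜 p (ι k) (n k)‖ ≤
        ∑ ε, (‖J‖ + ‖P‖) * ‖signSum ε z‖ := by
      have h2 : ‖((2 : 𝕜) ^ N)‖ = 2 ^ N := by simp
      rw [← h2, ← norm_smul, ← hsum]
      exact (norm_sum_le _ _).trans (Finset.sum_le_sum fun ε _ => hwn ε)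
    rw [← signAvg_mul_left, signAvg, le_inv_mul_iff₀ (by positivity)]
    exact h1
  nonneg N a := norm_nonneg _
  norm_le N a k := by
    have hinj : Function.Injective fun k : Fin N => (ι k, n k) := fun k l h =>
      Fin.val_injective (hn (Prod.mk.inj h).2)
    rw [← coordFun_sum_smul_unitVec hρ (p := p) hinj a k]
    exact ((coordFun hρ 𝕜 p (ι k) (n k)).le_opNorm _).trans
      (mul_le_of_le_one_left (norm_nonneg _) (norm_coordFun_le hρ (𝕜 := 𝕜) (p := p) _ _))
  norm_vec_le k := by
    refine (J.le_opNorm _).trans ?_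
    rw [norm_unitVec hρ, mul_one]
    linarith [norm_nonneg P]
  norm_dual_le k := by
    refine (ContinuousLinearMap.opNorm_comp_le _ _).trans ?_
    refine (mul_le_of_le_one_left (norm_nonneg P) (norm_coordFun_le hρ (𝕜 := 𝕜) (p := p) _ _)).trans ?_
    linarith [norm_nonneg J]

end Embedding

/-! ### From finitely supported functions to a lattice isomorphism -/

section LatticeIsomorphism

variable {I : Type*} [DecidableEq I] {ρ : FunctionNorm I} {𝕜 : Type*} [RCLike 𝕜]
  {p : ℝ≥0∞} [Fact (1 ≤ p)]

/-- Fatou property along an exhaustion of the countable index set by finite sets. -/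
lemma toFun_le_of_forall_indicator [Countable I] [Nonempty I] {B : ℝ≥0∞} {f : I → ℝ≥0}
    (h : ∀ A : Finset I, ρ.toFun ((A : Set I).indicator f) ≤ B) : ρ.toFun f ≤ B := by
  obtain ⟨g, hg⟩ := exists_surjective_nat I
  let A : ℕ → Finset I := fun n => (Finset.range n).image g
  have hA : Monotone A := fun m n hmn => Finset.image_subset_image (Finset.range_mono hmn)
  refine le_of_tendsto' (ρ.fatou' (fun n => (A n : Set I).indicator f) f (fun m n hmn => ?_)
    fun i => ?_) fun n => h (A n)
  · exact Set.indicator_le_indicator_of_subset (Finset.coe_subset.2 (hA hmn)) (fun _ => zero_le)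
  · obtain ⟨k, rfl⟩ := hg i
    refine tendsto_const_nhds.congr' ?_
    filter_upwards [eventually_gt_atTop k] with n hn
    refine (Set.indicator_of_mem ?_ f).symm
    exact Finset.mem_coe.2 (Finset.mem_image_of_mem g (Finset.mem_range.2 hn))

/-- A function norm equivalent to the `ℓ_p`-norm on finitely supported functions gives a space that
is lattice isomorphic to `ℓ_p`. -/
lemma latticeIsomorphicLp_of_equiv [Countable I] [Nonempty I] (hp : p ≠ ∞) {D : ℝ} (hD : 0 ≤ D)
    (hle : ∀ (A : Finset I) (f : I → ℝ≥0),
      (ρ.toFun ((A : Set I).indicator f)).toReal ≤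
        D * (∑ i ∈ A, (f i : ℝ) ^ p.toReal) ^ (1 / p.toReal))
    (hge : ∀ (A : Finset I) (f : I → ℝ≥0),
      (∑ i ∈ A, (f i : ℝ) ^ p.toReal) ^ (1 / p.toReal) ≤
        D * (ρ.toFun ((A : Set I).indicator f)).toReal) :
    LatticeIsomorphicLp ρ 𝕜 p := by
  have hp0 : 0 < p.toReal := toReal_pos_of_one_le hp
  -- Needed because `toReal` sends ∞ to 0: without finiteness, the upper estimate would say nothing
  -- about `ρ`.
  have hfin : ∀ (A : Finset I) (f : I → ℝ≥0), ρ.toFun ((A : Set I).indicator f) ≠ ∞ := by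
    intro A f
    have hle' : (A : Set I).indicator f ≤ (A.sup f) • (A : Set I).indicator 1 := by
      intro i
      by_cases hi : i ∈ A
      · simpa [hi] using Finset.le_sup (f := f) hi
      · simp [hi]
    refine ((ρ.mono' _ _ hle').trans_lt ?_).ne
    rw [ρ.smul']
    exact ENNReal.mul_lt_top ENNReal.coe_lt_top (ρ.indicator_lt_top' A)
  have hsum : ∀ (f : FnSpace ρ 𝕜) (A : Finset I),
      ∑ i ∈ A, ‖f i‖ ^ p.toReal ≤ (D * ‖f‖) ^ p.toReal := by
    intro f A
    have h1 := hge A fun i => ‖f i‖₊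
    have h2 : (ρ.toFun ((A : Set I).indicator fun i => ‖f i‖₊)).toReal ≤ ‖f‖ :=
      ENNReal.toReal_mono (FnSpace.enorm_ne_top f)
        (ρ.mono' _ _ (Set.indicator_le_self' fun _ _ => zero_le))
    simp only [coe_nnnorm] at h1
    have h0 : 0 ≤ ∑ i ∈ A, ‖f i‖ ^ p.toReal := by positivity
    have h3 := Real.rpow_le_rpow (by positivity)
      (h1.trans (mul_le_mul_of_nonneg_left h2 hD)) hp0.le
    rwa [← Real.rpow_mul h0, one_div_mul_cancel hp0.ne', Real.rpow_one] at h3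
  have hρle : ∀ g : lp (fun _ : I => 𝕜) p,
      ρ.toFun (fun i => ‖g i‖₊) ≤ ENNReal.ofReal (D * ‖g‖) := by
    intro g
    refine toFun_le_of_forall_indicator fun A => ?_
    rw [← ENNReal.ofReal_toReal (hfin A _)]
    refine ENNReal.ofReal_le_ofReal ((hle A _).trans ?_)
    gcongr
    have h1 := lp.sum_rpow_le_norm_rpow hp0 g A
    have h2 := Real.rpow_le_rpow (by positivity) h1 (by positivity : 0 ≤ 1 / p.toReal)
    rw [← Real.rpow_mul (norm_nonneg _), mul_one_div_cancel hp0.ne', Real.rpow_one] at h2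
    simpa using h2
  -- The identity on functions, which evidently commutes with moduli.
  let e : FnSpace ρ 𝕜 ≃ₗ[𝕜] lp (fun _ : I => 𝕜) p :=
    { toFun := fun f => ⟨fun i => f i, memℓp_gen' (hsum f)⟩
      map_add' := fun f g => rfl
      map_smul' := fun c f => rfl
      invFun := fun g => ⟨fun i => g i, (hρle g).trans_lt ENNReal.ofReal_lt_top⟩
      left_inv := fun f => rfl
      right_inv := fun g => rfl }
  refine ⟨e.toContinuousLinearEquivOfBounds D D (fun f => ?_) (fun g => ?_), fun f i => rfl⟩
  · exact lp.norm_le_of_forall_sum_le hp0 (by positivity) (hsum f)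
  · refine (ENNReal.toReal_mono ENNReal.ofReal_ne_top (hρle g)).trans ?_
    rw [ENNReal.toReal_ofReal (by positivity)]

end LatticeIsomorphism

/-! ### The two dichotomies combined -/

section Main

variable {I : Type*} [DecidableEq I] {ρ : FunctionNorm I}
  {𝕜 : Type*} [RCLike 𝕜] {p : ℝ≥0∞} [Fact (1 ≤ p)]

lemma norm_sum_smul_unitVec_of_injective (hρ : ρ.IsSequenceNorm) {N : ℕ}
    {ι : Fin N → I} (hι : Function.Injective ι) (n : Fin N → ℕ) (A : Finset I) (hA : ∀ i, i ∈ A ↔ ∃ k, ι k = i) (f : I → ℝ≥0) :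
    ‖∑ k, (((f (ι k) : ℝ) : 𝕜)) • unitVec hρ 𝕜 p (ι k) (n k)‖ =
      (ρ.toFun ((A : Set I).indicator f)).toReal := by
  rw [FnSpace.norm_def]
  congr 2
  ext i
  rw [FnSpace.coe_sum]
  by_cases hi : ∃ k, ι k = i
  · obtain ⟨k, rfl⟩ := hi
    have hmem : ι k ∈ (A : Set I) := (hA _).2 ⟨k, rfl⟩
    rw [Set.indicator_of_mem hmem, Finset.sum_eq_single k]
    · rw [FnSpace.coe_smul, Pi.smul_apply, unitVec, FnSpace.coe_single, Pi.single_eq_same,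
        coe_nnnorm, norm_smul, lp.norm_single (zero_lt_one.trans_le Fact.out)]
      simp
    · intro l _ hl
      rw [FnSpace.coe_smul, Pi.smul_apply, unitVec, FnSpace.coe_single,
        Pi.single_eq_of_ne fun h => hl (hι h.symm), smul_zero]
    · simp
  · have hmem : i ∉ (A : Set I) := fun h => hi ((hA i).1 h)
    rw [Set.indicator_of_notMem hmem, Finset.sum_eq_zero]
    · simp
    · intro k _
      rw [FnSpace.coe_smul, Pi.smul_apply, unitVec, FnSpace.coe_single,
        Pi.single_eq_of_ne fun h => hi ⟨k, h.symm⟩, smul_zero]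

variable {α β : Type*} {mα : MeasurableSpace α} {μ : Measure α}
  [IsProbabilityMeasure μ] {mβ : MeasurableSpace β} {ν : Measure β} [IsProbabilityMeasure ν]
  {r s : ℝ≥0∞} [Fact (1 ≤ r)] [Fact (1 ≤ s)]

/-- If `L_ρ(ℓ_p)` complementably embeds into `L_s(L_r)` and `p ≠ 2`, then `p = r`, or `p = s` and
`L_ρ` is lattice isomorphic to `ℓ_p`. -/
theorem eq_or_latticeIsomorphicLp_of_complementablyEmbeds [Countable I] [Nonempty I]
    (hρ : ρ.IsSequenceNorm) (hp : p ≠ ∞) (hr : r ≠ ∞) (hs : s ≠ ∞) (hp2 : p ≠ 2)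
    (h : ComplementablyEmbeds 𝕜 (FnSpace ρ (lp (fun _ : ℕ => 𝕜) p)) (Lp (Lp 𝕜 r ν) s μ)) :
    p = r ∨ (p = s ∧ LatticeIsomorphicLp ρ 𝕜 p) := by
  obtain ⟨J, P, hPJ⟩ := h
  have hp0 : 0 < p.toReal := toReal_pos_of_one_le hp
  have hPJ' : ∀ z, P (J z) = z := fun z => by
    have := DFunLike.congr_fun hPJ z
    simpa using this
  set C := ‖J‖ + ‖P‖ with hC
  set x : I → ℕ → Lp (Lp 𝕜 r ν) s μ := fun i n => J (unitVec hρ 𝕜 p i n) with hx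
  set y : I → ℕ → Lp (Lp 𝕜 r ν) s μ →L[𝕜] 𝕜 := fun i n => (coordFun hρ 𝕜 p i n).comp P with hy
  set T : ℕ → Lp (Lp 𝕜 r ν) s μ → Lp (Lp 𝕜 r ν) s μ := fun K =>
    (lipschitzWith_clamp K).compLp (clamp_zero K) with hT
  have hyx : ∀ i n, y i n (x i n) = 1 := fun i n => by
    change coordFun hρ 𝕜 p i n (P (J (unitVec hρ 𝕜 p i n))) = 1
    rw [hPJ', coordFun_apply, unitVec_apply, if_pos rfl]
  -- Outer dichotomy. In the first case it is essential that smallness holds for every i, since the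
  -- slices then may be chosen along any sequence of rows.
  by_cases hsmall : ∀ i K, ∀ δ' > 0, ∀ᶠ n in atTop, ‖y i n (T K (x i n))‖ < δ'
  · right
    have key : ∀ ι : ℕ → I, ∃ n : ℕ → ℕ, StrictMono n ∧ ∀ (N : ℕ) (a : Fin N → 𝕜),
        ‖∑ k : Fin N, a k • unitVec hρ 𝕜 p (ι k) (n k)‖ ≤ 6 * C ^ 2 * lnorm s.toReal a ∧
        lnorm s.toReal a ≤ 6 * C ^ 2 * ‖∑ k : Fin N, a k • unitVec hρ 𝕜 p (ι k) (n k)‖ := by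
      intro ι
      obtain ⟨n, K, L, hn, hKL, hK, hyu⟩ := exists_slices (T := T)
        (tendsto_compLp lipschitzWith_clamp clamp_zero tendsto_clamp hs)
        (x := fun k => x (ι k)) (y := fun k => y (ι k)) one_pos
        (fun k => Frequently.of_forall fun n => by rw [hyx, norm_one])
        (fun k => hsmall (ι k))
      refine ⟨n, hn, fun N a => ?_⟩
      refine (isSystem_of_embedding hρ J P hn.injective).equiv_of_slices hs hKL hK
        (u := fun k => T (L k) (x (ι k) (n k)) - T (K k) (x (ι k) (n k))) (fun k => ?_) hyu N a
      filter_upwards [(lipschitzWith_clamp (L k)).coeFn_compLp (clamp_zero _) (x (ι k) (n k)),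
        (lipschitzWith_clamp (K k)).coeFn_compLp (clamp_zero _) (x (ι k) (n k)),
        Lp.coeFn_sub (T (L k) (x (ι k) (n k))) (T (K k) (x (ι k) (n k)))] with ω h1 h2 h3
      rw [h3, Pi.sub_apply, hT, h1, h2]
      rfl
    have hps : p = s := by
      -- Within one row the unit vectors span ℓ_p isometrically, so equivalence with ℓ_s forces p =
      -- s.
      obtain ⟨n, hn, hequiv⟩ := key fun _ => Classical.arbitrary I
      have h1 : ∀ N : ℕ, (N : ℝ) ^ (1 / p.toReal) ≤ 6 * C ^ 2 * (N : ℝ) ^ (1 / s.toReal) ∧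
          (N : ℝ) ^ (1 / s.toReal) ≤ 6 * C ^ 2 * (N : ℝ) ^ (1 / p.toReal) := fun N => by
        have h2 := hequiv N fun _ => 1
        rwa [norm_sum_smul_unitVec_same hρ hp (n := fun k : Fin N => n k)
          (hn.injective.comp Fin.val_injective), lnorm_const, lnorm_const] at h2
      have h3 : 1 / p.toReal = 1 / s.toReal := le_antisymm
        (le_of_forall_mul_rpow_le one_pos fun N _ => by rw [one_mul]; exact (h1 N).1)
        (le_of_forall_mul_rpow_le one_pos fun N _ => by rw [one_mul]; exact (h1 N).2)
      rw [one_div, one_div, inv_inj] at h3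
      exact (ENNReal.toReal_eq_toReal_iff' hp hs).1 h3
    refine ⟨hps, ?_⟩
    subst hps
    have hboth : ∀ (A : Finset I) (f : I → ℝ≥0),
        (ρ.toFun ((A : Set I).indicator f)).toReal ≤
          6 * C ^ 2 * (∑ i ∈ A, (f i : ℝ) ^ p.toReal) ^ (1 / p.toReal) ∧
        (∑ i ∈ A, (f i : ℝ) ^ p.toReal) ^ (1 / p.toReal) ≤
          6 * C ^ 2 * (ρ.toFun ((A : Set I).indicator f)).toReal := by
      intro A f
      let e : A ≃ Fin A.card := A.equivFin
      -- One row for each element of A; the arbitrary values from `A.card` on only extend this to an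
      -- infinite sequence and are never tested. The n_k depend on A, but neither the norm of the
      -- combination nor the constant 6C² does.
      let ι : ℕ → I := fun k => if hk : k < A.card then (e.symm ⟨k, hk⟩ : I) else Classical.arbitrary I
      have hιe : ∀ k : Fin A.card, ι k = e.symm k := fun k => by simp [ι]
      obtain ⟨n, hn, hequiv⟩ := key ι
      have h1 := hequiv A.card fun k => ((f (ι k) : ℝ) : 𝕜)
      have hinj : Function.Injective fun k : Fin A.card => ι k := fun k l hkl => by
        simp only [hιe] at hkl
        exact e.symm.injective (Subtype.ext hkl)
      have hmem : ∀ i, i ∈ A ↔ ∃ k : Fin A.card, ι k = i := fun i =>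
        ⟨fun hi => ⟨e ⟨i, hi⟩, by rw [hιe, Equiv.symm_apply_apply]⟩, fun ⟨k, hk⟩ => by
          rw [← hk, hιe]; exact (e.symm k).2⟩
      rw [norm_sum_smul_unitVec_of_injective hρ hinj (fun k => n k) A hmem f] at h1
      have h2 : lnorm p.toReal (fun k : Fin A.card => ((f (ι k) : ℝ) : 𝕜)) =
          (∑ i ∈ A, (f i : ℝ) ^ p.toReal) ^ (1 / p.toReal) := by
        rw [lnorm, ← Finset.sum_coe_sort A, ← e.symm.sum_comp]
        simp [hιe]
      rwa [h2] at h1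
    exact latticeIsomorphicLp_of_equiv hp (by positivity) (fun A f => (hboth A f).1)
      fun A f => (hboth A f).2
  · left
    push Not at hsmall
    obtain ⟨i, K, δ, hδ, hfreq⟩ := hsmall
    have hsys : ∀ σ : ℕ → ℕ, StrictMono σ →
        IsSystem C (fun k => x i (σ k)) (fun k => y i (σ k)) fun _ a => lnorm p.toReal a := by
      intro σ hσ
      have := isSystem_of_embedding hρ J P (ι := fun _ => i) hσ.injective
      have hsame : ∀ (N : ℕ) (a : Fin N → 𝕜),
          ‖∑ k : Fin N, a k • unitVec hρ 𝕜 p i (σ k)‖ = lnorm p.toReal a := fun N a =>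
        norm_sum_smul_unitVec_same hρ hp (n := fun k : Fin N => σ k)
          (hσ.injective.comp Fin.val_injective) i a
      simpa only [hsame] using this
    rcases eq_two_or_eq_of_outer_truncations hr hs hp0 hsys hδ K hfreq with h2 | h2
    · refine absurd ?_ hp2
      rw [← ENNReal.ofReal_toReal hp, h2]
      simp
    · exact (ENNReal.toReal_eq_toReal_iff' hp hr).1 h2

end Main

end MixedNorm

theorem theorem3p10 {𝕜 : Type*} [RCLike 𝕜] {I : Type*} [Countable I] [Nonempty I]
    (p r s : ℝ≥0∞) [Fact (1 ≤ p)] [Fact (1 ≤ r)] [Fact (1 ≤ s)]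
    (hp : p ≠ ∞) (hr : r ≠ ∞) (hs : s ≠ ∞) (hp2 : p ≠ 2)
    (ρ : MixedNorm.FunctionNorm I) (hρ : ρ.IsSequenceNorm)
    (h : MixedNorm.ComplementablyEmbeds 𝕜
      (MixedNorm.FnSpace ρ (lp (fun _ : ℕ => 𝕜) p)) (MixedNorm.MixedLp 𝕜 s r)) :
    (min r s ≤ p ∧ p ≤ max r s) ∧
      (p < 2 ∨ 1 < s → p = r ∨ (p = s ∧ MixedNorm.LatticeIsomorphicLp ρ 𝕜 p)) := by
  classical
  have : IsProbabilityMeasure MixedNorm.leb := ⟨by simp [MixedNorm.leb]⟩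
  have key := MixedNorm.eq_or_latticeIsomorphicLp_of_complementablyEmbeds hρ hp hr hs hp2 h
  refine ⟨?_, fun _ => key⟩
  rcases key with rfl | ⟨rfl, -⟩
  · exact ⟨min_le_left _ _, le_max_left _ _⟩
  · exact ⟨min_le_right _ _, le_max_right _ _⟩
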